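/- **Theorem (one-clock priced timed automata with two stopwatch costs).** A (labelled) priced timed automaton with one clock $x$ and two costs is a tuple $\mathcal A=(Q,q_0,E,\mathrm{Inv},\mathrm{cost}_1,\mathrm{cost}_2,\ell)$, where $Q$ is a finite set of locations, $q_0\in Q$ is the initial location, $E$ is a finite set of transitions $(q,g,R,q')$ with $q,q'\in Q$, $R\subseteq\{x\}$ and $g$ a guard, $\mathrm{Inv}$ maps each location to a guard (its invariant), $\mathrm{cost}_i\colon Q\cup E\to\mathbb N$, and $\ell$ maps each location to a finite set of atomic propositions. Guards are finite nonempty conjunctions of constraints $x\sim c$ with $c\in\mathbb N$ and $\sim\,\in\{<,\le,=,\ge,>\}$. The cost $\mathrm{cost}_i$ is *stopwatch* if $\mathrm{cost}_i(Q)\subseteq\{0,1\}$. For $v,v',t\in\mathbb R_{\ge 0}$ there is a mixed move $(q,v)\xrightarrow{t,e}(q',v')$ via $e=(q,g,R,q')\in E$ if $v+t'\models\mathrm{Inv}(q)$ for all $0\le t'\le t$, $v+t\models g$, $v'=0$ if $x\in R$ and $v'=v+t$ otherwise, and $v'\models\mathrm{Inv}(q')$; its $i$-th cost is $t\cdot\mathrm{cost}_i(q)+\mathrm{cost}_i(e)$.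 The automaton is *non-blocking* if $0\models\mathrm{Inv}(q_0)$ and every state $(q,v)$ with $v\models\mathrm{Inv}(q)$ has an outgoing mixed move. A finite run $\varrho$ is a finite sequence of $|\varrho|\ge 0$ consecutive mixed moves; $\mathrm{cost}_i(\varrho)$ is the sum of their $i$-th costs, and $\varrho_{\le\pi}$, $\varrho_{\ge\pi}$ are the prefix and the suffix of $\varrho$ at position $\pi\le|\varrho|$. WMTL formulas are given by $\varphi::=a\mid\neg\varphi\mid\varphi\vee\varphi\mid\varphi\,\mathbf U_{\mathrm{cost}_i\sim c}\,\varphi$, with $a$ an atomic proposition, $i\in\{1,2\}$, $c\in\mathbb N$ and $\sim\,\in\{<,\le,=,\ge,>\}$. For a finite run $\varrho$ starting in location $q$: $\varrho\models a$ iff $a\in\ell(q)$; negation and disjunction are as usual; and $\varrho\models\varphi_1\,\mathbf U_{\mathrm{cost}_i\sim c}\,\varphi_2$ iff there is $0<\pi\le|\varrho|$ such that $\varrho_{\ge\pi}\models\varphi_2$, $\varrho_{\ge\pi'}\models\varphi_1$ for all $0<\pi'<\pi$, and $\mathrm{cost}_i(\varrho_{\le\pi})\sim c$. Then the following problem is undecidable: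 given a non-blocking priced timed automaton $\mathcal A$ with one clock and two costs, both of them stopwatch, and a WMTL formula $\varphi$, decide whether there is a finite run $\varrho$ of $\mathcal A$ starting in the initial state $(q_0,0)$ such that $\varrho\models\varphi$. That is, under a standard injective coding of automata and formulas by natural numbers, no computable function gives the correct answer on every such pair $(\mathcal A,\varphi)$. -/

import Mathlib

open scoped NNReal

namespace PricedTimed

/-- The comparison operators `<, ≤, =, ≥, >` of clock and cost constraints. -/
inductive Cmp where
  | lt | le | eq | ge | gt
  deriving DecidableEq

/-- `op.Holds a b` is the relation `a ∼ b` on nonnegative reals. -/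
def Cmp.Holds : Cmp → ℝ≥0 → ℝ≥0 → Prop
  | .lt, a, b => a < b
  | .le, a, b => a ≤ b
  | .eq, a, b => a = b
  | .ge, a, b => b ≤ a
  | .gt, a, b => b < a

/-- Clock constraints over `k` clocks: `g ::= x ∼ c ∣ g ∧ g` with `c ∈ ℕ`. -/
inductive Guard (k : ℕ) where
  | atom (x : Fin k) (op : Cmp) (c : ℕ)
  | and (g₁ g₂ : Guard k)
  deriving DecidableEq

/-- Clock valuations. -/
abbrev Val (k : ℕ) : Type := Fin k → ℝ≥0

/-- `v ⊨ g`. -/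
def Guard.Sat {k : ℕ} (v : Val k) : Guard k → Prop
  | .atom x op c => op.Holds (v x) (c : ℝ≥0)
  | .and g₁ g₂ => g₁.Sat v ∧ g₂.Sat v

/-- `v + t`. -/
def Val.delay {k : ℕ} (v : Val k) (t : ℝ≥0) : Val k := fun x => v x + t

/-- `[R ← 0]v`. -/
def Val.reset {k : ℕ} (v : Val k) (R : Finset (Fin k)) : Val k :=
  fun x => if x ∈ R then 0 else v x

/-- Transitions `(q, g, R, q')` over `n` locations and `k` clocks. -/
structure Transition (n k : ℕ) where
  src : Fin n
  guard : Guard k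
  resets : Finset (Fin k)
  tgt : Fin n
  deriving DecidableEq

/-- A labelled priced timed automaton with `k` clocks and `p` cost functions, as a finite object.
The locations are the elements of `Fin numLoc`, atomic propositions are natural numbers.
The finite set `E` of transitions together with the values of the cost functions on `E` is given
as a table: an entry `(e, w)` means `e ∈ E` and `cost_i(e) = w i` for every `i`; since every
transition has only one entry, the costs of transitions are functions on `E`. -/
structure PPTA (k p : ℕ) where
  numLoc : ℕ
  init : Fin numLoc
  edges : List (Transition numLoc k × (Fin p → ℕ))
  edges_nodup : (edges.map Prod.fst).Nodup
  inv : Fin numLoc → Guard k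
  locCost : Fin p → Fin numLoc → ℕ
  /-- `a ∈ label q` means that the proposition `a` holds in the location `q`. -/
  label : Fin numLoc → List ℕ

namespace PPTA

variable {k p : ℕ}

/-- A cost function is stopwatch if its slopes, i.e. its values on locations, lie in `{0, 1}`. -/
def IsStopwatch (A : PPTA k p) (i : Fin p) : Prop :=
  Set.range (A.locCost i) ⊆ {0, 1}

/-- A location together with a clock valuation. -/
structure State (A : PPTA k p) where
  loc : Fin A.numLoc
  val : Val k

/-- The type of entries of the transition table. -/
abbrev Edge (A : PPTA k p) : Type := Transition A.numLoc k × (Fin p → ℕ)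

/-- The initial state: all clocks are zero. -/
def initState (A : PPTA k p) : A.State := ⟨A.init, fun _ => 0⟩

/-- Delay moves `s –t→ s'`. -/
def DelayMove (A : PPTA k p) (s : A.State) (t : ℝ≥0) (s' : A.State) : Prop :=
  (∀ t' ≤ t, (A.inv s.loc).Sat (s.val.delay t')) ∧ s' = ⟨s.loc, s.val.delay t⟩

/-- Discrete moves `s –e→ s'`. -/
def DiscreteMove (A : PPTA k p) (s : A.State) (e : A.Edge) (s' : A.State) : Prop :=
  e ∈ A.edges ∧ e.1.src = s.loc ∧ e.1.guard.Sat s.val ∧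
    s' = ⟨e.1.tgt, s.val.reset e.1.resets⟩ ∧ (A.inv s'.loc).Sat s'.val

/-- Mixed moves `s –t,e→ s'`: a delay move followed by a discrete move. -/
def MixedMove (A : PPTA k p) (s : A.State) (t : ℝ≥0) (e : A.Edge) (s' : A.State) : Prop :=
  ∃ s₁, A.DelayMove s t s₁ ∧ A.DiscreteMove s₁ e s'

/-- The initial state satisfies its invariant, and every state that satisfies its invariant has
an outgoing mixed move. -/
def NonBlocking (A : PPTA k p) : Prop :=
  (A.inv A.init).Sat A.initState.val ∧
    ∀ s : A.State, (A.inv s.loc).Sat s.val → ∃ t e s', A.MixedMove s t e s'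

/-- Finite runs: `length` mixed moves `state 0 –delay 0, edge 0→ state 1 → ⋯ → state length`.
Values of `state` beyond `length`, and of `delay` and `edge` from `length` on, are irrelevant. -/
structure Run (A : PPTA k p) where
  length : ℕ
  state : ℕ → A.State
  delay : ℕ → ℝ≥0
  edge : ℕ → A.Edge
  step : ∀ j < length, A.MixedMove (state j) (delay j) (edge j) (state (j + 1))

namespace Run

variable {A : PPTA k p}

/-- The `i`-th cost of a run: every mixed move costs its delay times the slope of the location
in which the delay takes place, plus the cost of its transition. -/
noncomputable def cost (ρ : A.Run) (i : Fin p) : ℝ≥0 :=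
  ∑ j ∈ Finset.range ρ.length,
    (ρ.delay j * (A.locCost i (ρ.state j).loc : ℝ≥0) + ((ρ.edge j).2 i : ℝ≥0))

/-- The part of `ρ` that ends at position `π ≤ |ρ|`. -/
def take (ρ : A.Run) (π : ℕ) : A.Run where
  length := min π ρ.length
  state := ρ.state
  delay := ρ.delay
  edge := ρ.edge
  step := fun j hj => ρ.step j (lt_of_lt_of_le hj (min_le_right _ _))

/-- The part of `ρ` that starts at position `π ≤ |ρ|`. -/
def drop (ρ : A.Run) (π : ℕ) : A.Run where
  length := ρ.length - π
  state := fun j => ρ.state (π + j)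
  delay := fun j => ρ.delay (π + j)
  edge := fun j => ρ.edge (π + j)
  step := fun j hj => ρ.step (π + j) (by omega)

end Run

end PPTA

/-- WMTL formulas for `p` cost functions: `φ ::= a ∣ ¬φ ∣ φ ∨ φ ∣ φ U[cost_i ∼ c] φ`. -/
inductive WMTL (p : ℕ) where
  | atom (a : ℕ)
  | neg (φ : WMTL p)
  | disj (φ ψ : WMTL p)
  | untl (i : Fin p) (op : Cmp) (c : ℕ) (φ ψ : WMTL p)

/-- `ρ ⊨ φ` for finite runs (point-based semantics, strict until). -/
def WMTL.Sat {k p : ℕ} {A : PPTA k p} : A.Run → WMTL p → Prop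
  | ρ, .atom a => a ∈ A.label (ρ.state 0).loc
  | ρ, .neg φ => ¬ WMTL.Sat ρ φ
  | ρ, .disj φ ψ => WMTL.Sat ρ φ ∨ WMTL.Sat ρ ψ
  | ρ, .untl i op c φ ψ => ∃ π, 0 < π ∧ π ≤ ρ.length ∧ WMTL.Sat (ρ.drop π) ψ ∧
      (∀ π', 0 < π' → π' < π → WMTL.Sat (ρ.drop π') φ) ∧
      op.Holds ((ρ.take π).cost i) (c : ℝ≥0)

/-- Existential model checking: some finite run from the initial state satisfies `φ`. -/
def ModelChecks {k p : ℕ} (A : PPTA k p) (φ : WMTL p) : Prop :=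
  ∃ ρ : A.Run, ρ.state 0 = A.initState ∧ WMTL.Sat ρ φ

/-! Inputs of algorithms: automata and formulas are coded as natural numbers. -/

/-- Code of a comparison operator. -/
def Cmp.code : Cmp → ℕ
  | .lt => 0
  | .le => 1
  | .eq => 2
  | .ge => 3
  | .gt => 4

/-- Code of a clock constraint. -/
def Guard.code {k : ℕ} : Guard k → ℕ
  | .atom x op c => Nat.pair 0 (Nat.pair x (Nat.pair op.code c))
  | .and g₁ g₂ => Nat.pair 1 (Nat.pair g₁.code g₂.code)

/-- Code of a formula. -/
def WMTL.code {p : ℕ} : WMTL p → ℕ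
  | .atom a => Nat.pair 0 a
  | .neg φ => Nat.pair 1 φ.code
  | .disj φ ψ => Nat.pair 2 (Nat.pair φ.code ψ.code)
  | .untl i op c φ ψ =>
      Nat.pair 3 (Nat.pair i (Nat.pair op.code (Nat.pair c (Nat.pair φ.code ψ.code))))

/-- An entry of the transition table, written out in terms of lists and numbers. -/
def edgeData {n k p : ℕ} (e : Transition n k × (Fin p → ℕ)) :
    ℕ × ℕ × List Bool × ℕ × List ℕ :=
  (e.1.src, e.1.guard.code, List.ofFn fun x => decide (x ∈ e.1.resets), e.1.tgt, List.ofFn e.2)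

/-- The data of a location, written out in terms of lists and numbers. -/
def PPTA.locData {k p : ℕ} (A : PPTA k p) (q : Fin A.numLoc) : ℕ × List ℕ × List ℕ :=
  ((A.inv q).code, List.ofFn fun i => A.locCost i q, A.label q)

/-- An automaton, written out in terms of lists and numbers. -/
def PPTA.data {k p : ℕ} (A : PPTA k p) :
    ℕ × List (ℕ × ℕ × List Bool × ℕ × List ℕ) × List (ℕ × List ℕ × List ℕ) :=
  (A.init, A.edges.map edgeData, List.ofFn A.locData)

/-- Code of an automaton. -/
def PPTA.code {k p : ℕ} (A : PPTA k p) : ℕ := Encodable.encode A.data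

/-! Different objects have different codes. -/

theorem Cmp.code_injective : Function.Injective Cmp.code := by
  intro a b h
  cases a <;> cases b <;> simp_all [Cmp.code]

theorem Guard.code_injective {k : ℕ} : Function.Injective (Guard.code (k := k)) := by
  intro g
  induction g with
  | atom x op c =>
    rintro (_ | _) h
    · simp only [Guard.code, Nat.pair_eq_pair, true_and] at h
      obtain ⟨h1, h2, h3⟩ := h
      rw [Fin.ext h1, Cmp.code_injective h2, h3]
    · simp [Guard.code] at h
  | and g₁ g₂ ih₁ ih₂ =>
    rintro (_ | _) h
    · simp [Guard.code] at h
    · simp only [Guard.code, Nat.pair_eq_pair, true_and] at h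
      rw [ih₁ h.1, ih₂ h.2]

theorem WMTL.code_injective {p : ℕ} : Function.Injective (WMTL.code (p := p)) := by
  intro φ
  induction φ with
  | atom a => rintro (_ | _ | _ | _) h <;> simp_all [WMTL.code]
  | neg φ ih =>
    rintro (_ | _ | _ | _) h <;> simp [WMTL.code] at h
    rw [ih h]
  | disj φ ψ ih₁ ih₂ =>
    rintro (_ | _ | _ | _) h <;> simp [WMTL.code] at h
    rw [ih₁ h.1, ih₂ h.2]
  | untl i op c φ ψ ih₁ ih₂ =>
    rintro (_ | _ | _ | _) h <;> simp only [WMTL.code, Nat.pair_eq_pair] at h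
    · simp at h
    · simp at h
    · simp at h
    · obtain ⟨-, h1, h2, h3, h4, h5⟩ := h
      rw [Fin.ext h1, Cmp.code_injective h2, h3, ih₁ h4, ih₂ h5]

theorem edgeData_injective {n k p : ℕ} :
    Function.Injective (edgeData (n := n) (k := k) (p := p)) := by
  rintro ⟨⟨s, g, R, t⟩, w⟩ ⟨⟨s', g', R', t'⟩, w'⟩ h
  simp only [edgeData, Prod.mk.injEq, List.ofFn_inj] at h
  obtain ⟨h1, h2, h3, h4, h5⟩ := h
  have hR : R = R' := by
    ext x
    simpa using congrFun h3 x
  rw [Fin.ext h1, Guard.code_injective h2, hR, Fin.ext h4, h5]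

theorem PPTA.code_injective {k p : ℕ} : Function.Injective (PPTA.code (k := k) (p := p)) := by
  rintro ⟨n, i, E, hE, I, C, L⟩ ⟨n', i', E', hE', I', C', L'⟩ h
  have h' := Encodable.encode_injective h
  simp only [PPTA.data, Prod.mk.injEq] at h'
  obtain ⟨h1, h2, h3⟩ := h'
  have hn : n = n' := by simpa using congrArg List.length h3
  subst hn
  have h2' := List.map_injective_iff.2 edgeData_injective h2
  have h3' := List.ofFn_inj.1 h3
  have hI : I = I' := funext fun q => by
    have := congrFun h3' q
    simp only [PPTA.locData, Prod.mk.injEq] at this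
    exact Guard.code_injective this.1
  have hC : C = C' := funext fun j => funext fun q => by
    have := congrFun h3' q
    simp only [PPTA.locData, Prod.mk.injEq, List.ofFn_inj] at this
    exact congrFun this.2.1 j
  have hL : L = L' := funext fun q => by
    have := congrFun h3' q
    simp only [PPTA.locData, Prod.mk.injEq] at this
    exact this.2.2
  have hi : i = i' := Fin.ext h1
  subst hi hI hC hL h2'
  rfl

/-- The model-checking problem for the automata of a class `C` and all WMTL formulas is decidable:
some computable function gives the correct answer on (the code of) every pair `(A, φ)` with
`A ∈ C`. On other inputs it may answer anything. -/
def ModelCheckingDecidable {k p : ℕ} (C : Set (PPTA k p)) : Prop :=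
  ∃ f : ℕ → Bool, Computable f ∧ ∀ A ∈ C, ∀ φ : WMTL p,
    (f (Nat.pair A.code φ.code) = true ↔ ModelChecks A φ)

end PricedTimed

/-! The halting problem is reduced to model checking over one fixed automaton; only a constant in
the formula varies.

Time is cut into blocks of length 5, each with two locations. The time spent in the first location
stores a number in [0, 5): a stack word, read as a base-5 expansion with digits 1 to 4. The second
cost is plain time. Requiring that a switch to the second location be followed by another such
switch exactly 5D later therefore says that the D-th next block stores the same number (`link_iff`).

One machine step takes six blocks. Clock constraints in block 0 test the top symbol. Pop and push
multiply and divide by 5, which slopes 0 and 1 cannot do directly; instead one number is kept in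
five blocks and the first cost sums over the copies. Let v be the old number, w the new one and d
the digit. Between the switches of blocks 0 and 5 the first cost is 5(5 - v) + w + 5d for a pop and
(5 - v) + 5w + (20 - 5d) for a push. Demanding the value 25 gives w = 5(v - d) and w = d + v/5
respectively (`acc_zero_cell`, `IsFaithful.dur_end`). The four stacks are treated in cyclic order,
so a single fixed delay carries every result to the next step on the same stack. Runs satisfying the
formula thus correspond to halting computations (`exists_comp_of_modelChecks`,
`modelChecks_of_comp`).

The machine runs the four-stack program of a `ToPartrec.Code`; a statement waits for the turn of its
stack (`respects_simStep`). The input 2^n - 1 consists of n equal bits. A loop guesses n, and the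
formula fixes it by prescribing the time 30(4n + 4) at which the loop is left (`modelChecks_iff`).
The automaton does not depend on n and the code of the formula is primitive recursive in n, so a
decision function would solve the halting problem (`exists_code_halting`). -/

namespace PricedTimed

/-! ### Automata over an arbitrary finite type of locations -/

/-- Presentation of a one-clock automaton with two costs in which guard, reset and cost of a
transition depend only on its source. -/
structure LocSystem (L : Type) where
  init : L
  inv : L → Guard 1
  guard : L → Guard 1
  resets : L → Finset (Fin 1)
  succ : L → L → Prop
  wt : L → Fin 2 → ℕ
  slope : Fin 2 → L → ℕ
  label : L → List ℕ

namespace LocSystem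

variable {L : Type} [Fintype L] (S : LocSystem L)

/-- The numbering of the locations. -/
noncomputable def enc : L ≃ Fin (Fintype.card L) := Fintype.equivFin L

/-- The entry of the transition table for a pair of locations. -/
noncomputable def entry (p : L × L) : Transition (Fintype.card L) 1 × (Fin 2 → ℕ) :=
  (⟨enc p.1, S.guard p.1, S.resets p.1, enc p.2⟩, S.wt p.1)

open scoped Classical in
/-- The priced timed automaton of a presentation. -/
noncomputable def toPPTA : PPTA 1 2 where
  numLoc := Fintype.card L
  init := enc S.init
  edges := (Finset.univ.filter fun p : L × L => S.succ p.1 p.2).toList.map S.entry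
  edges_nodup := by
    rw [List.map_map]
    refine List.Nodup.map ?_ (Finset.nodup_toList _)
    rintro ⟨a, b⟩ ⟨c, d⟩ h
    simp only [Function.comp_apply, entry, Transition.mk.injEq, EmbeddingLike.apply_eq_iff_eq] at h
    exact Prod.ext h.1 h.2.2.2
  inv := fun q => S.inv (enc.symm q)
  locCost := fun i q => S.slope i (enc.symm q)
  label := fun q => S.label (enc.symm q)

/-- The location of a state. -/
noncomputable def locOf (s : S.toPPTA.State) : L := enc.symm s.loc

/-- The state with a given location and valuation. -/
noncomputable def mkState (l : L) (v : Val 1) : S.toPPTA.State := ⟨enc l, v⟩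

@[simp] theorem locOf_mkState (l : L) (v : Val 1) : S.locOf (S.mkState l v) = l := by
  simp [locOf, mkState]

@[simp] theorem val_mkState (l : L) (v : Val 1) : (S.mkState l v).val = v := rfl

theorem mem_edges {e : S.toPPTA.Edge} :
    e ∈ S.toPPTA.edges ↔ ∃ l l', S.succ l l' ∧ S.entry (l, l') = e := by
  classical
  refine List.mem_map.trans ⟨?_, ?_⟩
  · rintro ⟨⟨l, l'⟩, h, rfl⟩
    exact ⟨l, l', (Finset.mem_filter.1 (Finset.mem_toList.1 h)).2, rfl⟩
  · rintro ⟨l, l', h, rfl⟩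
    exact ⟨(l, l'), Finset.mem_toList.2 (Finset.mem_filter.2 ⟨Finset.mem_univ _, h⟩), rfl⟩

theorem mixedMove_iff {s s' : S.toPPTA.State} {t : ℝ≥0} {e : S.toPPTA.Edge} :
    S.toPPTA.MixedMove s t e s' ↔ ∃ l', S.succ (S.locOf s) l' ∧
      (∀ t' ≤ t, (S.inv (S.locOf s)).Sat (s.val.delay t')) ∧
      (S.guard (S.locOf s)).Sat (s.val.delay t) ∧
      s' = S.mkState l' ((s.val.delay t).reset (S.resets (S.locOf s))) ∧
      e = S.entry (S.locOf s, l') ∧ (S.inv l').Sat s'.val := by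
  constructor
  · rintro ⟨s₁, ⟨hd, rfl⟩, he, hsrc, hg, hs', hi⟩
    obtain ⟨l, l', hl, rfl⟩ := S.mem_edges.1 he
    have h : S.locOf s = l := by
      rw [locOf, ← show enc l = s.loc from hsrc]; simp
    subst h
    refine ⟨l', hl, hd, hg, hs', rfl, ?_⟩
    have : S.locOf s' = l' := by rw [hs']; exact S.locOf_mkState _ _
    rw [← this]
    exact hi
  · rintro ⟨l', hl, hd, hg, hs', rfl, hi⟩
    refine ⟨⟨s.loc, s.val.delay t⟩, ⟨hd, rfl⟩, S.mem_edges.2 ⟨_, _, hl, rfl⟩, ?_, hg, hs', ?_⟩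
    · exact enc.apply_symm_apply s.loc
    · have : S.locOf s' = l' := by rw [hs', locOf_mkState]
      rw [← this] at hi
      exact hi

variable {S}

/-- Accumulated cost of the first `k` moves of a run. -/
noncomputable def acc (ρ : S.toPPTA.Run) (i : Fin 2) (k : ℕ) : ℝ :=
  ∑ j ∈ Finset.range k,
    ((ρ.delay j : ℝ) * S.slope i (S.locOf (ρ.state j)) + S.wt (S.locOf (ρ.state j)) i)

theorem acc_succ (ρ : S.toPPTA.Run) (i : Fin 2) (k : ℕ) :
    acc ρ i (k + 1) = acc ρ i k +
      ((ρ.delay k : ℝ) * S.slope i (S.locOf (ρ.state k)) + S.wt (S.locOf (ρ.state k)) i) :=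
  Finset.sum_range_succ _ _

@[simp] theorem acc_zero (ρ : S.toPPTA.Run) (i : Fin 2) : acc ρ i 0 = 0 := by simp [acc]

theorem edge_eq (ρ : S.toPPTA.Run) {j : ℕ} (hj : j < ρ.length) (i : Fin 2) :
    (ρ.edge j).2 i = S.wt (S.locOf (ρ.state j)) i := by
  obtain ⟨l', -, -, -, -, he, -⟩ := S.mixedMove_iff.1 (ρ.step j hj)
  rw [he]; rfl

/-- Edge weights are determined by the source location, so the cost of a factor is a difference of
prefix sums. Every cost constraint becomes an equation between values of `acc`. -/
theorem cost_take_drop (ρ : S.toPPTA.Run) (i : Fin 2) {a m : ℕ} (h : a + m ≤ ρ.length) :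
    ((((ρ.drop a).take m).cost i : ℝ≥0) : ℝ) = acc ρ i (a + m) - acc ρ i a := by
  have h' : ((ρ.drop a).take m).length = m := by
    simp only [PPTA.Run.take, PPTA.Run.drop]; omega
  simp only [PPTA.Run.cost, h']
  rw [acc, acc, Finset.sum_range_add_sub_sum_range]
  push_cast
  refine Finset.sum_congr rfl fun j hj => ?_
  simp only [PPTA.Run.take, PPTA.Run.drop]
  rw [edge_eq ρ (by rw [Finset.mem_range] at hj; omega)]
  rfl

end LocSystem

/-! ### Derived operators of WMTL -/

namespace WMTL

/-- A valid formula. -/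
def top : WMTL 2 := .disj (.atom 0) (.neg (.atom 0))

/-- Conjunction. -/
def conj (φ ψ : WMTL 2) : WMTL 2 := .neg (.disj (.neg φ) (.neg ψ))

/-- Implication. -/
def imp (φ ψ : WMTL 2) : WMTL 2 := .disj (.neg φ) ψ

/-- At all later positions. -/
def always (φ : WMTL 2) : WMTL 2 := .neg (.untl 0 .ge 0 top (.neg φ))

/-- At some later position, at which the `i`-th cost is `c`. -/
def evAt (i : Fin 2) (c : ℕ) (φ : WMTL 2) : WMTL 2 := .untl i .eq c top φ

/-- At some later position. -/
def ev (φ : WMTL 2) : WMTL 2 := .untl 0 .ge 0 top φ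

variable {A : PPTA 1 2} {ρ : A.Run} {φ ψ : WMTL 2}

theorem sat_top : Sat ρ top := by
  simp only [top, Sat]; exact em _

theorem sat_conj : Sat ρ (conj φ ψ) ↔ Sat ρ φ ∧ Sat ρ ψ := by
  simp only [conj, Sat]; tauto

theorem sat_imp : Sat ρ (imp φ ψ) ↔ (Sat ρ φ → Sat ρ ψ) := by
  simp only [imp, Sat]; tauto

theorem sat_always : Sat ρ (always φ) ↔ ∀ π, 0 < π → π ≤ ρ.length → Sat (ρ.drop π) φ := by
  simp only [always, Sat]
  refine ⟨fun h π h0 h1 => ?_, ?_⟩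
  · by_contra hc
    exact h ⟨π, h0, h1, hc, fun _ _ _ => sat_top, by simp [Cmp.Holds]⟩
  · rintro h ⟨π, h0, h1, hc, -⟩
    exact hc (h π h0 h1)

theorem sat_ev : Sat ρ (ev φ) ↔ ∃ π, 0 < π ∧ π ≤ ρ.length ∧ Sat (ρ.drop π) φ := by
  simp only [ev, Sat]
  exact ⟨fun ⟨π, h0, h1, h2, _⟩ => ⟨π, h0, h1, h2⟩,
    fun ⟨π, h0, h1, h2⟩ => ⟨π, h0, h1, h2, fun _ _ _ => sat_top, by simp [Cmp.Holds]⟩⟩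

theorem sat_evAt {i : Fin 2} {c : ℕ} : Sat ρ (evAt i c φ) ↔
    ∃ π, 0 < π ∧ π ≤ ρ.length ∧ Sat (ρ.drop π) φ ∧ ((ρ.take π).cost i : ℝ) = c := by
  simp only [evAt, Sat, Cmp.Holds]
  refine exists_congr fun π => ?_
  rw [← NNReal.coe_inj]
  simp only [NNReal.coe_natCast]
  exact ⟨fun ⟨h0, h1, h2, _, h3⟩ => ⟨h0, h1, h2, h3⟩,
    fun ⟨h0, h1, h2, h3⟩ => ⟨h0, h1, h2, fun _ _ _ => sat_top, h3⟩⟩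

end WMTL

/-! ### Cost-constrained operators as conditions on positions and accumulated costs -/

namespace LocSystem

variable {L : Type} [Fintype L] {S : LocSystem L} (ρ : S.toPPTA.Run)

/-- The proposition `a` holds at position `k`. -/
def At (k a : ℕ) : Prop := a ∈ S.label (S.locOf (ρ.state k))

theorem sat_atom_drop {k a : ℕ} : WMTL.Sat (ρ.drop k) (.atom a) ↔ At ρ k a := by
  simp only [WMTL.Sat]; rfl

theorem sat_drop_evAt_atom {i : Fin 2} {c k a : ℕ} (hk : k ≤ ρ.length) :
    WMTL.Sat (ρ.drop k) (WMTL.evAt i c (.atom a)) ↔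
      ∃ k', k < k' ∧ k' ≤ ρ.length ∧ At ρ k' a ∧ acc ρ i k' = acc ρ i k + c := by
  rw [WMTL.sat_evAt]
  constructor
  · rintro ⟨m, h0, h1, h2, h3⟩
    have h1' : m ≤ ρ.length - k := h1
    refine ⟨k + m, by omega, by omega, ?_, ?_⟩
    · exact h2
    · rw [cost_take_drop ρ i (by omega)] at h3; linarith
  · rintro ⟨k', h0, h1, h2, h3⟩
    obtain ⟨m, rfl⟩ := Nat.exists_eq_add_of_lt h0
    refine ⟨m + 1, by omega, show m + 1 ≤ ρ.length - k by omega, ?_, ?_⟩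
    · exact h2
    · rw [cost_take_drop ρ i (by omega), show k + (m + 1) = k + m + 1 by omega]; linarith

/-- A cost that may stay constant does not determine a position. With `¬a` on the left of the until,
the witness is the next position where `a` holds, and the cost is measured there. -/
theorem sat_drop_untl_atom {i : Fin 2} {c k a : ℕ} (hk : k ≤ ρ.length) :
    WMTL.Sat (ρ.drop k) (.untl i .eq c (.neg (.atom a)) (.atom a)) ↔
      ∃ k', k < k' ∧ k' ≤ ρ.length ∧ At ρ k' a ∧ (∀ k'', k < k'' → k'' < k' → ¬ At ρ k'' a) ∧
        acc ρ i k' = acc ρ i k + c := by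
  simp only [WMTL.Sat, Cmp.Holds, ← NNReal.coe_inj, NNReal.coe_natCast]
  constructor
  · rintro ⟨m, h0, h1, h2, h4, h3⟩
    have h1' : m ≤ ρ.length - k := h1
    refine ⟨k + m, by omega, by omega, ?_, ?_, ?_⟩
    · exact h2
    · intro k'' hk1 hk2
      obtain ⟨m', rfl⟩ := Nat.exists_eq_add_of_lt hk1
      exact h4 (m' + 1) (by omega) (by omega)
    · rw [cost_take_drop ρ i (by omega)] at h3; linarith
  · rintro ⟨k', h0, h1, h2, h4, h3⟩
    obtain ⟨m, rfl⟩ := Nat.exists_eq_add_of_lt h0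
    refine ⟨m + 1, by omega, show m + 1 ≤ ρ.length - k by omega, ?_, ?_, ?_⟩
    · exact h2
    · intro m' hm1 hm2
      exact h4 (k + m') (by omega) (by omega)
    · rw [cost_take_drop ρ i (by omega), show k + (m + 1) = k + m + 1 by omega]; linarith

theorem sat_evAt_atom {i : Fin 2} {c a : ℕ} : WMTL.Sat ρ (WMTL.evAt i c (.atom a)) ↔
    ∃ k, 0 < k ∧ k ≤ ρ.length ∧ At ρ k a ∧ acc ρ i k = c := by
  simpa [PPTA.Run.drop] using sat_drop_evAt_atom ρ (i := i) (c := c) (a := a) (Nat.zero_le _)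

end LocSystem

end PricedTimed

namespace PricedTimed

open Turing.PartrecToTM2 (Γ')

/-! ### Cyclic stack machines -/

/-- Operations on a stack. -/
inductive StackAct where
  | keep
  | pop
  | push (a : Γ')

/-- The effect of an operation. -/
def StackAct.app : StackAct → List Γ' → List Γ'
  | .keep, w => w
  | .pop, w => w.tail
  | .push a, w => a :: w

/-! ### Stacks as numbers in base five -/

/-- The symbols as digits in base `5`. -/
def dig : Γ' → ℕ
  | .consₗ => 1
  | .cons => 2
  | .bit0 => 3
  | .bit1 => 4

theorem one_le_dig (a : Γ') : 1 ≤ dig a := by cases a <;> decide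

theorem dig_le (a : Γ') : dig a ≤ 4 := by cases a <;> decide

theorem dig_injective : Function.Injective dig := by
  intro a b h
  cases a <;> cases b <;> simp_all [dig]

/-- The number that represents a stack. -/
noncomputable def value : List Γ' → ℝ
  | [] => 0
  | a :: w => dig a + value w / 5

theorem value_nonneg (w : List Γ') : 0 ≤ value w := by
  induction w with
  | nil => exact le_rfl
  | cons a w ih => rw [value]; positivity

theorem value_lt (w : List Γ') : value w < 5 := by
  induction w with
  | nil => norm_num [value]
  | cons a w ih =>
    have : (dig a : ℝ) ≤ 4 := by exact_mod_cast dig_le a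
    rw [value]; linarith

/-- The condition on a number to represent a stack with a given top symbol. -/
def TopBound : Option Γ' → ℝ → Prop
  | none, t => t ≤ 0
  | some a, t => (dig a : ℝ) ≤ t ∧ t < dig a + 1

theorem topBound_value (w : List Γ') : TopBound w.head? (value w) := by
  cases w with
  | nil => exact le_rfl
  | cons a w =>
    have h1 := value_nonneg w
    have h2 := value_lt w
    constructor <;> rw [value] <;> linarith

theorem TopBound.lt {o : Option Γ'} {t : ℝ} (h : TopBound o t) : t < 5 := by
  cases o with
  | none => exact lt_of_le_of_lt h (by norm_num)
  | some a =>
    have : (dig a : ℝ) ≤ 4 := by exact_mod_cast dig_le a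
    linarith [h.2]

/-- The intervals [d, d + 1) for different digits are disjoint. Digits start at 1, which keeps them
apart from the value 0 of the empty stack. -/
theorem TopBound.eq_head? {w : List Γ'} {o : Option Γ'} (h : TopBound o (value w)) :
    o = w.head? := by
  have h' := topBound_value w
  generalize w.head? = o' at h'
  generalize value w = t at h h'
  have key : ∀ a b : Γ', TopBound (some a) t → TopBound (some b) t → dig a ≤ dig b := by
    intro a b ha hb
    have : (dig a : ℝ) < dig b + 1 := lt_of_le_of_lt ha.1 hb.2
    exact Nat.lt_succ_iff.1 (by exact_mod_cast this)
  have key' : ∀ a : Γ', TopBound (some a) t → TopBound none t → False := by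
    intro a ha hb
    have h1 : (1 : ℝ) ≤ dig a := by exact_mod_cast one_le_dig a
    have h2 : t ≤ 0 := hb
    linarith [ha.1]
  rcases o with _ | a <;> rcases o' with _ | b
  · rfl
  · exact (key' b h' h).elim
  · exact (key' a h h').elim
  · rw [dig_injective (le_antisymm (key a b h h') (key b a h' h))]

/-- A nondeterministic machine with four stacks. The stacks form a queue: every transition is
applied to the first of them, which becomes the last one. A transition can be taken if the top
symbol of this stack is the one observed. -/
structure CyclicMachine where
  E : Type
  [fintypeE : Fintype E]
  P : Type
  src : E → P
  tgt : E → P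
  obs : E → Option Γ'
  act : E → StackAct
  first : E
  halt : P
  IsStart : E → Prop
  -- Makes the automaton non-blocking.
  exists_next : ∀ e, ∃ e', src e' = tgt e
  tgt_of_src_halt : ∀ e, src e = halt → tgt e = halt
  src_ne_halt_of_isStart : ∀ e, IsStart e → src e ≠ halt
  obs_of_pop : ∀ e, act e = .pop → obs e ≠ none
  -- The first four steps meet the four stacks for the first time, and no earlier block fixes their
  -- values. Observing `none` forces these values to be 0.
  obs_initial : ∀ (e : ℕ → E) (j : ℕ), j < 4 → e 0 = first →
    (∀ i < j, src (e (i + 1)) = tgt (e i)) → obs (e j) = none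

attribute [instance] CyclicMachine.fintypeE

namespace CyclicMachine

variable (M : CyclicMachine)

/-- The stacks in the order in which the transitions `e 0, e 1, …` are applied to them. -/
def stackSeq (e : ℕ → M.E) : ℕ → List Γ'
  | j => if h : j < 4 then [] else (M.act (e (j - 4))).app (stackSeq e (j - 4))

theorem stackSeq_of_lt (e : ℕ → M.E) {j : ℕ} (h : j < 4) : M.stackSeq e j = [] := by
  rw [stackSeq, dif_pos h]

theorem stackSeq_add_four (e : ℕ → M.E) (j : ℕ) :
    M.stackSeq e (j + 4) = (M.act (e j)).app (M.stackSeq e j) := by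
  rw [stackSeq, dif_neg (by omega)]; simp

/-- The first `T` transitions can be taken one after the other. -/
def IsComp (e : ℕ → M.E) (T : ℕ) : Prop :=
  e 0 = M.first ∧ (∀ j < T, M.src (e (j + 1)) = M.tgt (e j)) ∧
    ∀ j < T, (M.stackSeq e j).head? = M.obs (e j)

/-! ### The automaton of a cyclic machine -/

/-- Phases of the simulation: for every transition six blocks of two locations. -/
abbrev Loc : Type := M.E × Fin 6 × Bool

/-- Invariant of the first location of a block. -/
def invFst (o : Option Γ') : Guard 1 :=
  match o with
  | none => .atom 0 .le 0
  | some a => .atom 0 .lt (dig a + 1)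

/-- Guard of the first location of a block. -/
def guardFst (o : Option Γ') : Guard 1 :=
  match o with
  | none => .atom 0 .ge 0
  | some a => .atom 0 .ge (dig a)

/-- Invariants. -/
def inv : M.Loc → Guard 1
  | (e, b, false) => if b = 0 then invFst (M.obs e) else .atom 0 .lt 5
  | (_, _, true) => .atom 0 .le 5

/-- Guards. -/
def guard : M.Loc → Guard 1
  | (e, b, false) => if b = 0 then guardFst (M.obs e) else .atom 0 .ge 0
  | (_, _, true) => .atom 0 .eq 5

/-- Resets. -/
def resets : M.Loc → Finset (Fin 1)
  | (_, _, false) => ∅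
  | (_, _, true) => {0}

/-- Succession of locations. -/
def succ : M.Loc → M.Loc → Prop
  | (e, b, false), l => l = (e, b, true)
  | (e, b, true), l => (b.val + 1 = l.2.1.val ∧ l.1 = e ∧ l.2.2 = false) ∨
      (b = 5 ∧ l.2.1 = 0 ∧ l.2.2 = false ∧ M.src l.1 = M.tgt e)

/-- The digit of the observed symbol. -/
def obsDig : Option Γ' → ℕ
  | none => 0
  | some a => dig a

/-- The discrete part of the first cost of a transition. -/
def actWt (o : Option Γ') : StackAct → ℕ
  | .keep => 25
  | .pop => 5 * obsDig o
  | .push a => 20 - 5 * dig a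

/-- The slopes of the first cost. -/
def actSlope : StackAct → Fin 6 → Bool → ℕ
  | .keep, _, _ => 0
  | .pop, b, true => if b = 5 then 0 else 1
  | .pop, b, false => if b = 5 then 1 else 0
  | .push _, b, true => if b = 0 then 1 else 0
  | .push _, b, false => if b = 0 then 0 else 1

/-- The costs of transitions. -/
def wt : M.Loc → Fin 2 → ℕ
  | (e, b, ph), i => if i = 0 ∧ b = 0 ∧ ph = true then actWt (M.obs e) (M.act e) else 0

/-- The slopes of the costs. -/
def slope (i : Fin 2) : M.Loc → ℕ
  | (e, b, ph) => if i = 0 then actSlope (M.act e) b ph else 1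

/-- Between the blocks `b` and `b + 1` of a transition the value must not change. -/
def ActLink : StackAct → Fin 6 → Prop
  | .keep, b => b ≠ 5
  | .pop, b => b ≠ 5 ∧ b ≠ 4
  | .push _, b => b ≠ 5 ∧ b ≠ 0

/-- The atomic propositions that hold in a location. -/
def Lab : ℕ → M.Loc → Prop
  | 0, (_, _, ph) => ph = true
  | 1, (e, b, ph) => ph = true ∧ M.src e ≠ M.halt ∧ ActLink (M.act e) b
  | 2, (e, b, ph) => ph = true ∧ M.src e ≠ M.halt ∧ b = 5
  | 3, (e, b, ph) => ph = true ∧ M.src e ≠ M.halt ∧ b = 0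
  | 4, (_, b, ph) => ph = true ∧ b = 5
  | 5, (e, _, _) => M.src e = M.halt
  | 6, (e, b, ph) => ph = false ∧ b = 0 ∧ M.IsStart e
  | _, _ => False

open scoped Classical in
/-- The system of locations of a cyclic machine. -/
noncomputable def system : LocSystem M.Loc where
  init := (M.first, 0, false)
  inv := M.inv
  guard := M.guard
  resets := M.resets
  succ := M.succ
  wt := M.wt
  slope := M.slope
  label := fun l => (List.range 7).filter fun a => M.Lab a l

/-- The automaton of a cyclic machine. -/
noncomputable abbrev auto : PPTA 1 2 := M.system.toPPTA

/-! ### Moves of the automaton; it is non-blocking and has stopwatch costs -/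

variable {M}

theorem sat_inv_false {e : M.E} {b : Fin 6} {v : Val 1} (h : (M.inv (e, b, false)).Sat v)
    (h' : (M.guard (e, b, false)).Sat v) :
    if b = 0 then TopBound (M.obs e) (v 0) else (v 0 : ℝ) < 5 := by
  simp only [inv, guard] at h h'
  split_ifs at h h' ⊢
  · cases ho : M.obs e with
    | none =>
      rw [ho] at h
      simp only [invFst, Guard.Sat, Cmp.Holds, ← NNReal.coe_le_coe] at h
      simpa [TopBound] using h
    | some a =>
      rw [ho] at h h'
      simp only [invFst, guardFst, Guard.Sat, Cmp.Holds, ← NNReal.coe_le_coe,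
        ← NNReal.coe_lt_coe] at h h'
      exact ⟨by simpa using h', by simpa using h⟩
  · simp only [Guard.Sat, Cmp.Holds, ← NNReal.coe_lt_coe] at h
    simpa using h

theorem sat_inv_guard_of_topBound {e : M.E} {b : Fin 6} {v : Val 1}
    (h : if b = 0 then TopBound (M.obs e) (v 0) else (v 0 : ℝ) < 5) :
    (M.inv (e, b, false)).Sat v ∧ (M.guard (e, b, false)).Sat v := by
  simp only [inv, guard]
  split_ifs at h ⊢
  · cases ho : M.obs e with
    | none =>
      rw [ho] at h
      simp only [invFst, guardFst, Guard.Sat, Cmp.Holds, ← NNReal.coe_le_coe]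
      exact ⟨by simpa [TopBound] using h, by simp⟩
    | some a =>
      rw [ho] at h
      simp only [invFst, guardFst, Guard.Sat, Cmp.Holds, ← NNReal.coe_le_coe,
        ← NNReal.coe_lt_coe]
      exact ⟨by simpa using h.2, by simpa using h.1⟩
  · simp only [Guard.Sat, Cmp.Holds, ← NNReal.coe_lt_coe]
    exact ⟨by simpa using h, by simp⟩

/-- Invariants of first locations are upper bounds only, so they need checking just at the end of a
delay. -/
theorem inv_false_mono {e : M.E} {b : Fin 6} {v w : Val 1} (hvw : v 0 ≤ w 0)
    (h : (M.inv (e, b, false)).Sat w) : (M.inv (e, b, false)).Sat v := by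
  simp only [inv] at h ⊢
  split_ifs at h ⊢
  · cases ho : M.obs e with
    | none =>
      rw [ho] at h
      exact hvw.trans h
    | some a =>
      rw [ho] at h
      exact hvw.trans_lt h
  · exact hvw.trans_lt h

theorem sat_inv_false_zero (e : M.E) (b : Fin 6) (v : Val 1) (hv : v 0 = 0) :
    (M.inv (e, b, false)).Sat v := by
  simp only [inv]
  split_ifs
  · cases ho : M.obs e with
    | none => simp [invFst, Guard.Sat, Cmp.Holds, hv]
    | some a => simp [invFst, Guard.Sat, Cmp.Holds, hv]
  · simp [Guard.Sat, Cmp.Holds, hv]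

theorem lt_five_of_bound {o : Option Γ'} {b : Fin 6} {t : ℝ}
    (h : if b = 0 then TopBound o t else t < 5) : t < 5 := by
  split_ifs at h
  · exact h.lt
  · exact h

/-- Non-blocking concerns all valuations, reachable or not. The lower bound on the clock sits in the
guard and not in the invariant, so it can be met by waiting until the clock shows the digit. -/
theorem exists_bound_of_inv {e : M.E} {b : Fin 6} {v : Val 1}
    (h : (M.inv (e, b, false)).Sat v) :
    ∃ t : ℝ≥0, if b = 0 then TopBound (M.obs e) (v.delay t 0) else (v.delay t 0 : ℝ) < 5 := by
  simp only [inv] at h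
  split_ifs at h ⊢
  · cases ho : M.obs e with
    | none =>
      rw [ho] at h
      simp only [invFst, Guard.Sat, Cmp.Holds, ← NNReal.coe_le_coe] at h
      exact ⟨0, by simpa [TopBound, Val.delay] using h⟩
    | some a =>
      rw [ho] at h
      simp only [invFst, Guard.Sat, Cmp.Holds, ← NNReal.coe_lt_coe] at h
      push_cast at h
      rcases le_total (dig a : ℝ≥0) (v 0) with h1 | h1
      · rw [← NNReal.coe_le_coe] at h1
        exact ⟨0, by simpa [TopBound, Val.delay] using ⟨h1, h⟩⟩
      · refine ⟨(dig a : ℝ≥0) - v 0, ?_⟩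
        simp [TopBound, Val.delay, add_tsub_cancel_of_le h1]
  · simp only [Guard.Sat, Cmp.Holds, ← NNReal.coe_lt_coe] at h
    exact ⟨0, by simpa [Val.delay] using h⟩

theorem mixedMove_fst {s : M.auto.State} {e : M.E} {b : Fin 6} (hs : M.system.locOf s = (e, b, false))
    {t : ℝ≥0} (ht : if b = 0 then TopBound (M.obs e) (s.val.delay t 0)
      else (s.val.delay t 0 : ℝ) < 5) :
    M.auto.MixedMove s t (M.system.entry ((e, b, false), (e, b, true)))
      (M.system.mkState (e, b, true) (s.val.delay t)) := by
  obtain ⟨h1, h2⟩ := sat_inv_guard_of_topBound ht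
  refine (M.system.mixedMove_iff).2 ⟨(e, b, true), ?_, ?_, ?_, ?_, ?_, ?_⟩
  · rw [hs]; rfl
  · rw [hs]
    exact fun t' ht' => inv_false_mono (add_le_add_right ht' _) h1
  · rw [hs]; exact h2
  · rw [hs]
    congr 1
  · rw [hs]
  · have := lt_five_of_bound ht
    simp only [system, inv, Guard.Sat, Cmp.Holds, ← NNReal.coe_le_coe]
    exact this.le

theorem mixedMove_snd {s : M.auto.State} {e e' : M.E} {b b' : Fin 6}
    (hs : M.system.locOf s = (e, b, true)) (hv : s.val 0 ≤ 5)
    (hsucc : M.succ (e, b, true) (e', b', false)) :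
    M.auto.MixedMove s (5 - s.val 0) (M.system.entry ((e, b, true), (e', b', false)))
      (M.system.mkState (e', b', false) fun _ => 0) := by
  have h5 : s.val.delay (5 - s.val 0) 0 = 5 := add_tsub_cancel_of_le hv
  refine (M.system.mixedMove_iff).2 ⟨(e', b', false), ?_, ?_, ?_, ?_, ?_, ?_⟩
  · rw [hs]; exact hsucc
  · rw [hs]
    intro t' ht'
    have : s.val.delay t' 0 ≤ 5 := h5 ▸ (add_le_add_right ht' _ : _ ≤ s.val 0 + (5 - s.val 0))
    exact this
  · rw [hs]; exact h5
  · rw [hs]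
    congr 1
    funext x
    rw [Subsingleton.elim x 0]
    simp [Val.reset, system, resets]
  · rw [hs]
  · exact sat_inv_false_zero _ _ _ rfl

theorem move_fst {s s' : M.auto.State} {e : M.E} {b : Fin 6} {t : ℝ≥0} {d : M.auto.Edge}
    (hs : M.system.locOf s = (e, b, false)) (hv : s.val 0 = 0) (h : M.auto.MixedMove s t d s') :
    M.system.locOf s' = (e, b, true) ∧ s'.val 0 = t ∧
      if b = 0 then TopBound (M.obs e) t else (t : ℝ) < 5 := by
  obtain ⟨l', hl, h1, h2, rfl, -, -⟩ := M.system.mixedMove_iff.1 h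
  rw [hs] at hl h1 h2
  rw [LocSystem.locOf_mkState, LocSystem.val_mkState]
  have h3 : s.val.delay t 0 = t := by simp [Val.delay, hv]
  have h4 := sat_inv_false (h1 t le_rfl) h2
  rw [h3] at h4
  refine ⟨hl, ?_, h4⟩
  rw [hs, show M.system.resets (e, b, false) = ∅ from rfl]
  simpa [Val.reset] using h3

theorem move_snd {s s' : M.auto.State} {e : M.E} {b : Fin 6} {t : ℝ≥0} {d : M.auto.Edge}
    (hs : M.system.locOf s = (e, b, true)) (h : M.auto.MixedMove s t d s') :
    M.succ (e, b, true) (M.system.locOf s') ∧ s'.val 0 = 0 ∧ s.val 0 + t = 5 := by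
  obtain ⟨l', hl, h1, h2, rfl, -, -⟩ := M.system.mixedMove_iff.1 h
  rw [hs] at hl h1 h2
  rw [LocSystem.locOf_mkState, LocSystem.val_mkState]
  refine ⟨hl, ?_, h2⟩
  rw [hs, show M.system.resets (e, b, true) = {0} from rfl]
  simp [Val.reset]

theorem succ_exists (e : M.E) (b : Fin 6) : ∃ e' b', M.succ (e, b, true) (e', b', false) := by
  by_cases hb : b = 5
  · obtain ⟨e', he'⟩ := M.exists_next e
    exact ⟨e', 0, Or.inr ⟨hb, rfl, rfl, he'⟩⟩
  · exact ⟨e, ⟨b.val + 1, by omega⟩, Or.inl ⟨rfl, rfl, rfl⟩⟩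

theorem auto_nonBlocking : M.auto.NonBlocking := by
  constructor
  · have : M.system.locOf M.auto.initState = (M.first, 0, false) := M.system.locOf_mkState _ _
    have h := sat_inv_false_zero M.first 0 M.auto.initState.val rfl
    rw [← this] at h
    exact h
  · intro s hs
    change (M.inv (M.system.locOf s)).Sat s.val at hs
    rcases hl : M.system.locOf s with ⟨e, b, _ | _⟩
    · rw [hl] at hs
      obtain ⟨t, ht⟩ := exists_bound_of_inv hs
      exact ⟨_, _, _, mixedMove_fst hl ht⟩
    · rw [hl] at hs
      obtain ⟨e', b', h⟩ := succ_exists e b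
      exact ⟨_, _, _, mixedMove_snd hl hs h⟩

theorem auto_isStopwatch (i : Fin 2) : M.auto.IsStopwatch i := by
  rintro _ ⟨q, rfl⟩
  change M.slope i (M.system.locOf ⟨q, fun _ => 0⟩) ∈ _
  rcases M.system.locOf ⟨q, fun _ => 0⟩ with ⟨e, b, ph⟩
  simp only [slope]
  split_ifs
  · cases M.act e <;> cases ph <;> simp only [actSlope] <;> (try split_ifs) <;> simp
  · simp

theorem at_iff {ρ : M.auto.Run} {k a : ℕ} (ha : a < 7) :
    LocSystem.At ρ k a ↔ M.Lab a (M.system.locOf (ρ.state k)) := by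
  simp [LocSystem.At, system, ha]

end CyclicMachine

end PricedTimed

namespace PricedTimed

open Turing.PartrecToTM2 (Γ')

namespace CyclicMachine

variable {M : CyclicMachine}

/-! ### The structure of runs -/

section Structure

variable (ρ : M.auto.Run)

/-- The `j`-th transition of the machine in a run of its automaton. -/
noncomputable def trAt (j : ℕ) : M.E := (M.system.locOf (ρ.state (12 * j))).1

/-- The delay in the first location of the `i`-th block. -/
noncomputable def dur (i : ℕ) : ℝ := ρ.delay (2 * i)

variable {ρ}

theorem loc_snd_of_fst {i : ℕ} {e : M.E} {b : Fin 6} (hi : 2 * i + 1 ≤ ρ.length)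
    (h : M.system.locOf (ρ.state (2 * i)) = (e, b, false) ∧ (ρ.state (2 * i)).val 0 = 0) :
    M.system.locOf (ρ.state (2 * i + 1)) = (e, b, true) ∧
      (ρ.state (2 * i + 1)).val 0 = ρ.delay (2 * i) ∧
      if b = 0 then TopBound (M.obs e) (dur ρ i) else dur ρ i < 5 :=
  move_fst h.1 h.2 (ρ.step (2 * i) (by omega))

/-- Induction on the number of the block. For `b = 0` the predecessor is block 5 of the previous
step, and the transition is whatever `trAt` reads off; for `b > 0` it is inherited from block `b -
1`. -/
theorem loc_fst (h0 : ρ.state 0 = M.auto.initState) (i : ℕ) : ∀ (j : ℕ) (b : Fin 6),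
    i = 6 * j + b → 2 * i ≤ ρ.length →
    M.system.locOf (ρ.state (2 * i)) = (trAt ρ j, b, false) ∧ (ρ.state (2 * i)).val 0 = 0 := by
  induction i with
  | zero =>
    intro j b hj _
    obtain rfl : j = 0 := by omega
    obtain rfl : b = 0 := Fin.ext (by rw [Fin.val_zero]; omega)
    have h1 : M.system.locOf (ρ.state (12 * 0)) = (M.first, 0, false) := by
      rw [h0]; exact M.system.locOf_mkState _ _
    refine ⟨?_, ?_⟩
    · rw [trAt, h1]
    · rw [h0]; rfl
  | succ i ih =>
    intro j b hj hlen
    have prev : ∀ (j' : ℕ) (b' : Fin 6), i = 6 * j' + b' →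
        M.succ (trAt ρ j', b', true) (M.system.locOf (ρ.state (2 * (i + 1)))) ∧
          (ρ.state (2 * (i + 1))).val 0 = 0 := fun j' b' hj' => by
      have h := loc_snd_of_fst (by omega) (ih j' b' hj' (by omega))
      have h' := move_snd h.1 (ρ.step (2 * i + 1) (by omega))
      exact ⟨h'.1, h'.2.1⟩
    by_cases hb : b = 0
    · subst hb
      obtain ⟨j, rfl⟩ : ∃ j', j = j' + 1 := ⟨j - 1, by simp only [Fin.val_zero] at hj; omega⟩
      have hi : i = 6 * j + (5 : Fin 6).val := by
        simp only [Fin.val_zero] at hj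
        change i = 6 * j + 5
        omega
      obtain ⟨h1, h2⟩ := prev j 5 hi
      refine ⟨?_, h2⟩
      have h3 : 2 * (i + 1) = 12 * (j + 1) := by simp only [Fin.val_zero] at hj; omega
      rw [trAt, ← h3]
      rcases h1 with ⟨h1, -⟩ | ⟨-, h1, h4, -⟩
      -- There is no block 6, so block 5 can only be left towards a new transition.
      · have h6 := (M.system.locOf (ρ.state (2 * (i + 1)))).2.1.isLt
        have : (5 : Fin 6).val = 5 := rfl
        omega
      · exact Prod.ext rfl (Prod.ext h1 h4)
    · have hb' : 0 < b.val := Nat.pos_of_ne_zero fun h => hb (Fin.ext h)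
      obtain ⟨h1, h2⟩ := prev j ⟨b.val - 1, by omega⟩ (by simp only; omega)
      refine ⟨?_, h2⟩
      rcases h1 with ⟨h1, h3, h4⟩ | ⟨h1, -⟩
      · refine Prod.ext h3 (Prod.ext (Fin.ext ?_) h4)
        rw [← h1]; simp only; omega
      · have : b.val - 1 = 5 := congrArg Fin.val h1
        omega

theorem loc_snd (h0 : ρ.state 0 = M.auto.initState) {i j : ℕ} (b : Fin 6) (hi : i = 6 * j + b)
    (hl : 2 * i + 1 ≤ ρ.length) : M.system.locOf (ρ.state (2 * i + 1)) = (trAt ρ j, b, true) ∧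
      (ρ.state (2 * i + 1)).val 0 = ρ.delay (2 * i) ∧
      if b = 0 then TopBound (M.obs (trAt ρ j)) (dur ρ i) else dur ρ i < 5 :=
  loc_snd_of_fst hl (loc_fst h0 i j b hi (by omega))

theorem exists_block (i : ℕ) : ∃ (j : ℕ) (b : Fin 6), i = 6 * j + b :=
  ⟨i / 6, ⟨i % 6, Nat.mod_lt _ (by norm_num)⟩, (Nat.div_add_mod i 6).symm⟩

theorem dur_nonneg (i : ℕ) : 0 ≤ dur ρ i := NNReal.coe_nonneg _

theorem dur_lt (h0 : ρ.state 0 = M.auto.initState) {i : ℕ} (hl : 2 * i + 1 ≤ ρ.length) :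
    dur ρ i < 5 := by
  obtain ⟨j, b, hi⟩ := exists_block i
  exact lt_five_of_bound (loc_snd h0 b hi hl).2.2

theorem delay_snd (h0 : ρ.state 0 = M.auto.initState) {i : ℕ} (hl : 2 * i + 2 ≤ ρ.length) :
    (ρ.delay (2 * i + 1) : ℝ) = 5 - dur ρ i := by
  obtain ⟨j, b, hi⟩ := exists_block i
  have h := loc_snd h0 b hi (by omega)
  have h' := (move_snd h.1 (ρ.step (2 * i + 1) (by omega))).2.2
  rw [h.2.1, ← NNReal.coe_inj] at h'
  push_cast at h'
  rw [dur]; linarith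

theorem src_trAt_succ (h0 : ρ.state 0 = M.auto.initState) {j : ℕ} (hl : 12 * (j + 1) ≤ ρ.length) :
    M.src (trAt ρ (j + 1)) = M.tgt (trAt ρ j) := by
  have h := loc_snd h0 (i := 6 * j + 5) (5 : Fin 6) rfl (by omega)
  have h' := (move_snd h.1 (ρ.step _ (by omega))).1
  rw [show 2 * (6 * j + 5) + 1 + 1 = 12 * (j + 1) by ring] at h'
  rcases h' with ⟨h', -⟩ | ⟨-, -, -, h'⟩
  · have h6 := (M.system.locOf (ρ.state (12 * (j + 1)))).2.1.isLt
    have : (5 : Fin 6).val = 5 := rfl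
    omega
  · exact h'

theorem trAt_zero (h0 : ρ.state 0 = M.auto.initState) : trAt ρ 0 = M.first := by
  rw [trAt, mul_zero, h0]
  exact congrArg Prod.fst (M.system.locOf_mkState _ _)

/-! ### Costs of runs -/

theorem acc_one_succ (k : ℕ) :
    LocSystem.acc ρ 1 (k + 1) = LocSystem.acc ρ 1 k + ρ.delay k := by
  rw [LocSystem.acc_succ]
  simp [system, slope, wt]

/-- The second location is left when the clock is 5, so each block lasts 5, and the second cost has
slope 1 and no weights. -/
theorem acc_one_even (h0 : ρ.state 0 = M.auto.initState) {i : ℕ} (hl : 2 * i ≤ ρ.length) :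
    LocSystem.acc ρ 1 (2 * i) = 5 * i := by
  induction i with
  | zero => simp
  | succ i ih =>
    rw [show 2 * (i + 1) = 2 * i + 1 + 1 by ring, acc_one_succ, acc_one_succ, ih (by omega),
      delay_snd h0 (by omega), dur]
    push_cast; ring

theorem acc_one_odd (h0 : ρ.state 0 = M.auto.initState) {i : ℕ} (hl : 2 * i + 1 ≤ ρ.length) :
    LocSystem.acc ρ 1 (2 * i + 1) = 5 * i + dur ρ i := by
  rw [acc_one_succ, acc_one_even h0 (by omega), dur]

theorem lab_zero_iff (h0 : ρ.state 0 = M.auto.initState) {k : ℕ} (hk : k ≤ ρ.length) :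
    LocSystem.At ρ k 0 ↔ k % 2 = 1 := by
  rw [at_iff (by norm_num)]
  rcases Nat.even_or_odd' k with ⟨i, rfl | rfl⟩ <;> obtain ⟨j, b, hi⟩ := exists_block i
  · rw [(loc_fst h0 i j b hi hk).1]
    simp [Lab]
  · rw [(loc_snd h0 b hi hk).1]
    simp [Lab]

/-- Block `i'` switches at time `5 * i' + dur i'` with `dur i'` in [0, 5). Two switches exactly `5 *
D` apart have durations differing by less than 5, hence lie `D` blocks apart and have equal
durations. -/
theorem link_iff (h0 : ρ.state 0 = M.auto.initState) {i D : ℕ} (hi : 2 * i + 1 ≤ ρ.length)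
    (hD : 0 < D) :
    (∃ k', 2 * i + 1 < k' ∧ k' ≤ ρ.length ∧ LocSystem.At ρ k' 0 ∧
      LocSystem.acc ρ 1 k' = LocSystem.acc ρ 1 (2 * i + 1) + (5 * D : ℕ)) ↔
    2 * (i + D) + 1 ≤ ρ.length ∧ dur ρ (i + D) = dur ρ i := by
  constructor
  · rintro ⟨k', -, h1, h2, h3⟩
    rw [lab_zero_iff h0 h1] at h2
    obtain ⟨i', rfl⟩ : ∃ i', k' = 2 * i' + 1 := ⟨k' / 2, by omega⟩
    rw [acc_one_odd h0 h1, acc_one_odd h0 hi] at h3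
    have h4 := dur_lt h0 h1
    have h5 := dur_lt h0 hi
    have h6 := dur_nonneg (ρ := ρ) i
    have h7 := dur_nonneg (ρ := ρ) i'
    push_cast at h3
    have h8 : i' = i + D := by
      have ha : (i' : ℝ) < (i + D : ℕ) + 1 := by push_cast; linarith
      have hb : ((i + D : ℕ) : ℝ) < i' + 1 := by push_cast; linarith
      have ha' : i' < i + D + 1 := by exact_mod_cast ha
      have hb' : i + D < i' + 1 := by exact_mod_cast hb
      omega
    subst h8
    refine ⟨h1, ?_⟩
    push_cast at h3
    linarith
  · rintro ⟨h1, h2⟩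
    refine ⟨2 * (i + D) + 1, by omega, h1, (lab_zero_iff h0 h1).2 (by omega), ?_⟩
    rw [acc_one_odd h0 h1, acc_one_odd h0 hi, h2]
    push_cast; ring

theorem acc_zero_fst (h0 : ρ.state 0 = M.auto.initState) {i j : ℕ} (b : Fin 6)
    (hi : i = 6 * j + b) (hl : 2 * i ≤ ρ.length) :
    LocSystem.acc ρ 0 (2 * i + 1) =
      LocSystem.acc ρ 0 (2 * i) + dur ρ i * actSlope (M.act (trAt ρ j)) b false := by
  rw [LocSystem.acc_succ, (loc_fst h0 i j b hi hl).1]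
  simp [system, slope, wt, dur]

theorem acc_zero_snd (h0 : ρ.state 0 = M.auto.initState) {i j : ℕ} (b : Fin 6)
    (hi : i = 6 * j + b) (hl : 2 * i + 2 ≤ ρ.length) :
    LocSystem.acc ρ 0 (2 * (i + 1)) = LocSystem.acc ρ 0 (2 * i + 1) +
      ((5 - dur ρ i) * actSlope (M.act (trAt ρ j)) b true +
        if b = 0 then (actWt (M.obs (trAt ρ j)) (M.act (trAt ρ j)) : ℝ) else 0) := by
  rw [show 2 * (i + 1) = 2 * i + 1 + 1 by ring, LocSystem.acc_succ,
    (loc_snd h0 b hi (by omega)).1, delay_snd h0 hl]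
  simp [system, slope, wt]

/-- Measured from switch to switch: the second location of block 0, blocks 1 to 4 entirely, and the
first location of block 5. A location with slope 1 contributes `dur` or `5 - dur`, and the weight is
paid when block 0 is left. -/
theorem acc_zero_cell (h0 : ρ.state 0 = M.auto.initState) {j : ℕ} (hl : 12 * j + 11 ≤ ρ.length) :
    LocSystem.acc ρ 0 (2 * (6 * j + 5) + 1) = LocSystem.acc ρ 0 (2 * (6 * j) + 1) +
      match M.act (trAt ρ j) with
      | .keep => 25
      | .pop => (5 - dur ρ (6 * j)) + (5 - dur ρ (6 * j + 1)) + (5 - dur ρ (6 * j + 2)) +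
          (5 - dur ρ (6 * j + 3)) + (5 - dur ρ (6 * j + 4)) + dur ρ (6 * j + 5) +
          5 * obsDig (M.obs (trAt ρ j))
      | .push a => (5 - dur ρ (6 * j)) + dur ρ (6 * j + 1) + dur ρ (6 * j + 2) +
          dur ρ (6 * j + 3) + dur ρ (6 * j + 4) + dur ρ (6 * j + 5) + (20 - 5 * dig a) := by
  have f1 := acc_zero_fst h0 (i := 6 * j + 1) 1 rfl (by omega)
  have f2 := acc_zero_fst h0 (i := 6 * j + 2) 2 rfl (by omega)
  have f3 := acc_zero_fst h0 (i := 6 * j + 3) 3 rfl (by omega)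
  have f4 := acc_zero_fst h0 (i := 6 * j + 4) 4 rfl (by omega)
  have f5 := acc_zero_fst h0 (i := 6 * j + 5) 5 rfl (by omega)
  have s0 := acc_zero_snd h0 (i := 6 * j) 0 rfl (by omega)
  have s1 := acc_zero_snd h0 (i := 6 * j + 1) 1 rfl (by omega)
  have s2 := acc_zero_snd h0 (i := 6 * j + 2) 2 rfl (by omega)
  have s3 := acc_zero_snd h0 (i := 6 * j + 3) 3 rfl (by omega)
  have s4 := acc_zero_snd h0 (i := 6 * j + 4) 4 rfl (by omega)
  rw [f5, s4, f4, s3, f3, s2, f2, s1, f1, s0]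
  cases M.act (trAt ρ j) with
  | keep => simp [actSlope, actWt]
  | pop => simp [actSlope, actWt]; ring
  | push a =>
    -- The truncated subtraction in `actWt` is exact because digits are at most 4.
    have : 5 * dig a ≤ 20 := by have := dig_le a; omega
    simp [actSlope, actWt, Nat.cast_sub this]; ring

end Structure

end CyclicMachine

end PricedTimed

namespace PricedTimed

open Turing.PartrecToTM2 (Γ')

namespace CyclicMachine

variable {M : CyclicMachine}

/-! ### The formula -/

/-- The formula that describes the correct halting simulations in which the start transition is
taken at time `c`. -/
def haltFormula (c : ℕ) : WMTL 2 :=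
  -- One block later: equal numbers inside a step.
  .conj (.always (.imp (.atom 1) (.evAt 1 5 (.atom 0)))) <|
  -- 95 = 5 * 19: from block 5 of step j to block 0 of step j + 4, the next step on the same stack.
  .conj (.always (.imp (.atom 2) (.evAt 1 95 (.atom 0)))) <|
  -- From the switch of block 0 to that of block 5; the value 25 expresses the stack operation.
  .conj (.always (.imp (.atom 3) (.untl 0 .eq 25 (.neg (.atom 4)) (.atom 4)))) <|
  .conj (.ev (.atom 5)) (.evAt 1 c (.atom 6))

/-- The values of the blocks of a run simulate the operations of the machine. -/
structure IsFaithful (ρ : M.auto.Run) : Prop where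
  link : ∀ (j : ℕ) (b : Fin 6), 2 * (6 * j + b) + 1 ≤ ρ.length → M.src (trAt ρ j) ≠ M.halt →
    ActLink (M.act (trAt ρ j)) b →
    2 * (6 * j + b + 1) + 1 ≤ ρ.length ∧ dur ρ (6 * j + b + 1) = dur ρ (6 * j + b)
  copy : ∀ j : ℕ, 2 * (6 * j + 5) + 1 ≤ ρ.length → M.src (trAt ρ j) ≠ M.halt →
    2 * (6 * j + 5 + 19) + 1 ≤ ρ.length ∧ dur ρ (6 * j + 5 + 19) = dur ρ (6 * j + 5)
  op : ∀ j : ℕ, 2 * (6 * j) + 1 ≤ ρ.length → M.src (trAt ρ j) ≠ M.halt →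
    2 * (6 * j + 5) + 1 ≤ ρ.length ∧ LocSystem.acc ρ 0 (2 * (6 * j + 5) + 1) =
      LocSystem.acc ρ 0 (2 * (6 * j) + 1) + 25

variable {ρ : M.auto.Run}

theorem at_odd_iff (h0 : ρ.state 0 = M.auto.initState) {a j : ℕ} (b : Fin 6) (ha : a < 7)
    (hl : 2 * (6 * j + b) + 1 ≤ ρ.length) :
    LocSystem.At ρ (2 * (6 * j + b) + 1) a ↔ M.Lab a (trAt ρ j, b, true) := by
  rw [at_iff ha, (loc_snd h0 b rfl hl).1]

theorem at_even_iff (h0 : ρ.state 0 = M.auto.initState) {a j : ℕ} (b : Fin 6) (ha : a < 7)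
    (hl : 2 * (6 * j + b) ≤ ρ.length) :
    LocSystem.At ρ (2 * (6 * j + b)) a ↔ M.Lab a (trAt ρ j, b, false) := by
  rw [at_iff ha, (loc_fst h0 _ j b rfl hl).1]

theorem forall_at_iff (h0 : ρ.state 0 = M.auto.initState) {a : ℕ} (ha : a < 7)
    (hfst : ∀ (e : M.E) (b : Fin 6), ¬ M.Lab a (e, b, false)) (Q : ℕ → Prop) :
    (∀ k, 0 < k → k ≤ ρ.length → LocSystem.At ρ k a → Q k) ↔
      ∀ (j : ℕ) (b : Fin 6), 2 * (6 * j + b) + 1 ≤ ρ.length → M.Lab a (trAt ρ j, b, true) →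
        Q (2 * (6 * j + b) + 1) := by
  constructor
  · intro h j b hl hLab
    exact h _ (by omega) hl ((at_odd_iff h0 b ha hl).2 hLab)
  · intro h k _ hl hLab
    rcases Nat.even_or_odd' k with ⟨i, rfl | rfl⟩ <;> obtain ⟨j, b, rfl⟩ := exists_block i
    · exact (hfst _ _ ((at_even_iff h0 b ha hl).1 hLab)).elim
    · exact h j b hl ((at_odd_iff h0 b ha hl).1 hLab)

/-- Proposition 4 holds exactly at the positions congruent to 11 modulo 12, so the first one after
the switch of block 0 is the switch of block 5 of the same step. -/
theorem op_iff (h0 : ρ.state 0 = M.auto.initState) {j : ℕ} (hl : 2 * (6 * j) + 1 ≤ ρ.length) :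
    (∃ k', 2 * (6 * j) + 1 < k' ∧ k' ≤ ρ.length ∧ LocSystem.At ρ k' 4 ∧
      (∀ k'', 2 * (6 * j) + 1 < k'' → k'' < k' → ¬ LocSystem.At ρ k'' 4) ∧
      LocSystem.acc ρ 0 k' = LocSystem.acc ρ 0 (2 * (6 * j) + 1) + (25 : ℕ)) ↔
    2 * (6 * j + 5) + 1 ≤ ρ.length ∧ LocSystem.acc ρ 0 (2 * (6 * j + 5) + 1) =
      LocSystem.acc ρ 0 (2 * (6 * j) + 1) + 25 := by
  have hat : ∀ k, k ≤ ρ.length → (LocSystem.At ρ k 4 ↔ k % 12 = 11) := by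
    intro k hk
    rcases Nat.even_or_odd' k with ⟨i, rfl | rfl⟩ <;> obtain ⟨j, b, rfl⟩ := exists_block i
    · rw [at_even_iff h0 b (by norm_num) hk]
      simp only [Lab, Bool.false_eq_true, false_and, false_iff]
      omega
    · rw [at_odd_iff h0 b (by norm_num) hk]
      simp only [Lab, true_and]
      rw [Fin.ext_iff]
      change b.val = 5 ↔ _
      omega
  constructor
  · rintro ⟨k', h1, h2, h3, h4, h5⟩
    rw [hat k' h2] at h3
    have hk : k' = 2 * (6 * j + 5) + 1 := by
      by_contra hne
      have hlt : 2 * (6 * j + 5) + 1 < k' := by omega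
      exact h4 _ (by omega) hlt ((hat _ (by omega)).2 (by omega))
    subst hk
    exact ⟨h2, by exact_mod_cast h5⟩
  · rintro ⟨h1, h2⟩
    refine ⟨2 * (6 * j + 5) + 1, by omega, h1, (hat _ h1).2 (by omega), ?_,
      by exact_mod_cast h2⟩
    intro k'' h3 h4
    rw [hat _ (by omega)]
    omega

theorem sat_haltFormula_iff (h0 : ρ.state 0 = M.auto.initState) (c : ℕ) :
    WMTL.Sat ρ (haltFormula c) ↔ IsFaithful ρ ∧
      (∃ k, 0 < k ∧ k ≤ ρ.length ∧ LocSystem.At ρ k 5) ∧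
      ∃ k, 0 < k ∧ k ≤ ρ.length ∧ LocSystem.At ρ k 6 ∧ LocSystem.acc ρ 1 k = c := by
  simp only [haltFormula, WMTL.sat_conj, WMTL.sat_always, WMTL.sat_imp, WMTL.sat_ev,
    LocSystem.sat_atom_drop, LocSystem.sat_evAt_atom ρ]
  rw [forall_at_iff h0 (by norm_num) (by simp [Lab]), forall_at_iff h0 (by norm_num) (by simp [Lab]),
    forall_at_iff h0 (by norm_num) (by simp [Lab])]
  have key : ∀ A B C D : Prop, (A ∧ B ∧ C ∧ D ↔ (A ∧ B ∧ C) ∧ D) := fun _ _ _ _ => by tauto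
  rw [key]
  refine and_congr ?_ Iff.rfl
  constructor
  · rintro ⟨h1, h2, h3⟩
    refine ⟨fun j b hl hh ha => ?_, fun j hl hh => ?_, fun j hl hh => ?_⟩
    · have h := h1 j b hl ⟨rfl, hh, ha⟩
      replace h := (LocSystem.sat_drop_evAt_atom ρ hl).1 h
      exact (link_iff h0 hl one_pos).1 h
    · have h := h2 j 5 hl ⟨rfl, hh, rfl⟩
      replace h := (LocSystem.sat_drop_evAt_atom ρ hl).1 h
      exact (link_iff h0 hl (D := 19) (by norm_num)).1 h
    · have h := h3 j 0 hl ⟨rfl, hh, rfl⟩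
      replace h := (LocSystem.sat_drop_untl_atom ρ hl).1 h
      exact (op_iff h0 hl).1 h
  · rintro ⟨h1, h2, h3⟩
    refine ⟨fun j b hl hh => ?_, fun j b hl hh => ?_, fun j b hl hh => ?_⟩
    · refine (LocSystem.sat_drop_evAt_atom ρ hl).2 ?_
      exact (link_iff h0 hl one_pos).2 (h1 j b hl hh.2.1 hh.2.2)
    · obtain ⟨-, hh, rfl⟩ := hh
      refine (LocSystem.sat_drop_evAt_atom ρ hl).2 ?_
      exact (link_iff h0 hl (D := 19) (by norm_num)).2 (h2 j hl hh)
    · obtain ⟨-, hh, rfl⟩ := hh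
      refine (LocSystem.sat_drop_untl_atom ρ hl).2 ?_
      exact (op_iff h0 hl).2 (h3 j hl hh)

/-! ### From runs of the automaton to computations -/

/-- The links reduce the cost equation of `acc_zero_cell` to one linear equation between the old and
the new number. For `keep` the links alone suffice. -/
theorem IsFaithful.dur_end (hρ : IsFaithful ρ) (h0 : ρ.state 0 = M.auto.initState) {j : ℕ}
    (hl : 12 * j + 1 ≤ ρ.length) (hh : M.src (trAt ρ j) ≠ M.halt) {w : List Γ'}
    (hw : dur ρ (6 * j) = value w) (ho : M.obs (trAt ρ j) = w.head?) :
    2 * (6 * j + 5) + 1 ≤ ρ.length ∧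
      dur ρ (6 * j + 5) = value ((M.act (trAt ρ j)).app w) := by
  obtain ⟨h1, h2⟩ := hρ.op j (by omega) hh
  refine ⟨h1, ?_⟩
  rw [acc_zero_cell h0 (by omega)] at h2
  have l0 := fun h => (hρ.link j 0 (by simp only [Fin.val_zero]; omega) hh h).2
  have l1 := fun h => (hρ.link j 1 (by simp only [Fin.val_one]; omega) hh h).2
  have l2 := fun h => (hρ.link j 2 (by simp only [Fin.val_two]; omega) hh h).2
  have l3 := fun h => (hρ.link j 3 (by change 2 * (6 * j + 3) + 1 ≤ _; omega) hh h).2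
  have l4 := fun h => (hρ.link j 4 (by change 2 * (6 * j + 4) + 1 ≤ _; omega) hh h).2
  change _ → dur ρ (6 * j + 1) = dur ρ (6 * j) at l0
  change _ → dur ρ (6 * j + 2) = dur ρ (6 * j + 1) at l1
  change _ → dur ρ (6 * j + 3) = dur ρ (6 * j + 2) at l2
  change _ → dur ρ (6 * j + 4) = dur ρ (6 * j + 3) at l3
  change _ → dur ρ (6 * j + 5) = dur ρ (6 * j + 4) at l4
  cases ha : M.act (trAt ρ j) with
  | keep =>
    simp only [ha, ActLink] at l0 l1 l2 l3 l4
    rw [l4 (by decide), l3 (by decide), l2 (by decide), l1 (by decide), l0 (by decide), hw]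
    rfl
  | pop =>
    simp only [ha, ActLink] at h2 l0 l1 l2 l3
    have e1 := l0 (by decide)
    have e2 := l1 (by decide)
    have e3 := l2 (by decide)
    have e4 := l3 (by decide)
    have hne := M.obs_of_pop _ ha
    rw [ho] at hne h2
    cases w with
    | nil => simp at hne
    | cons x w =>
      simp only [List.head?_cons, obsDig] at h2
      rw [value] at hw
      simp only [StackAct.app, List.tail_cons]
      -- With v the old number and d the digit of `x`, 5(5 - v) + t + 5d = 25 gives t = 5(v - d),
      -- the value of the tail.
      linarith
  | push x =>
    simp only [ha, ActLink] at h2 l1 l2 l3 l4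
    have e2 := l1 (by decide)
    have e3 := l2 (by decide)
    have e4 := l3 (by decide)
    have e5 := l4 (by decide)
    simp only [StackAct.app, value]
    -- Here (5 - v) + 5t + (20 - 5d) = 25 gives t = d + v/5.
    linarith

theorem src_eq_halt_of_le {e : ℕ → M.E} {T j : ℕ} (hT : M.src (e T) = M.halt) (hTj : T ≤ j)
    (hchain : ∀ i < j, M.src (e (i + 1)) = M.tgt (e i)) : M.src (e j) = M.halt := by
  induction j, hTj using Nat.le_induction with
  | base => exact hT
  | succ j hj ih =>
    rw [hchain j (by omega)]
    exact M.tgt_of_src_halt _ (ih fun i hi => hchain i (by omega))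

theorem exists_comp_of_modelChecks {c : ℕ} (h : ModelChecks M.auto (haltFormula c)) :
    ∃ (e : ℕ → M.E) (T J : ℕ), J < T ∧ M.IsComp e T ∧ M.IsStart (e J) ∧ 30 * J = c ∧
      M.src (e T) = M.halt := by
  obtain ⟨ρ, h0, hsat⟩ := h
  obtain ⟨hρ, ⟨k, -, hk, hhalt⟩, ⟨k', -, hk', hstart, hc⟩⟩ := (sat_haltFormula_iff h0 c).1 hsat
  have hchain : ∀ j, 12 * (j + 1) ≤ ρ.length → M.src (trAt ρ (j + 1)) = M.tgt (trAt ρ j) :=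
    fun j hj => src_trAt_succ h0 hj
  have hex : ∃ T, 12 * T ≤ ρ.length ∧ M.src (trAt ρ T) = M.halt := by
    rcases Nat.even_or_odd' k with ⟨i, rfl | rfl⟩ <;> obtain ⟨j, b, rfl⟩ := exists_block i
    · exact ⟨j, by omega, (at_even_iff h0 b (by norm_num) hk).1 hhalt⟩
    · exact ⟨j, by omega, (at_odd_iff h0 b (by norm_num) hk).1 hhalt⟩
  obtain ⟨J, hJ, hJs, hJc⟩ : ∃ J, 12 * J ≤ ρ.length ∧ M.IsStart (trAt ρ J) ∧ 30 * J = c := by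
    rcases Nat.even_or_odd' k' with ⟨i, rfl | rfl⟩ <;> obtain ⟨j, b, rfl⟩ := exists_block i
    · obtain ⟨-, rfl, hs⟩ := (at_even_iff h0 b (by norm_num) hk').1 hstart
      refine ⟨j, by omega, hs, ?_⟩
      rw [acc_one_even h0 hk'] at hc
      have hc' : 5 * (6 * j + (0 : Fin 6).val) = c := by exact_mod_cast hc
      rw [Fin.val_zero] at hc'
      omega
    · exact absurd ((at_odd_iff h0 b (by norm_num) hk').1 hstart).1 (by simp)
  classical
  -- The formula constrains only transitions that do not start in the halting state, so `T` is
  -- chosen as the first one that does.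
  obtain ⟨hT, hTh⟩ := Nat.find_spec hex
  have hmin : ∀ j < Nat.find hex, M.src (trAt ρ j) ≠ M.halt := fun j hj hjh =>
    Nat.find_min hex hj ⟨by omega, hjh⟩
  generalize Nat.find hex = T at hT hTh hmin
  have hJT : J < T := by
    by_contra hle
    exact M.src_ne_halt_of_isStart _ hJs
      (src_eq_halt_of_le hTh (not_lt.1 hle) fun i hi => hchain i (by omega))
  have hval : ∀ j < T, dur ρ (6 * j) = value (M.stackSeq (trAt ρ) j) ∧
      M.obs (trAt ρ j) = (M.stackSeq (trAt ρ) j).head? := by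
    intro j
    induction j using Nat.strong_induction_on with
    | _ j ih =>
      intro hj
      have hb := (loc_snd h0 (i := 6 * j) (j := j) 0 (by simp) (by omega)).2.2
      rw [if_pos rfl] at hb
      have hv : dur ρ (6 * j) = value (M.stackSeq (trAt ρ) j) := by
        by_cases hj4 : j < 4
        · have hn := M.obs_initial (trAt ρ) j hj4 (trAt_zero h0) fun i hi => hchain i (by omega)
          rw [hn] at hb
          rw [M.stackSeq_of_lt _ hj4]
          exact le_antisymm hb (dur_nonneg _)
        · obtain ⟨i, rfl⟩ : ∃ i, j = i + 4 := ⟨j - 4, by omega⟩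
          obtain ⟨h1, h2⟩ := ih i (by omega) (by omega)
          -- Step `i` computes the new number in its block 5, and the copy condition moves it to
          -- block 0 of step `i + 4`.
          obtain ⟨h3, h4⟩ := hρ.dur_end h0 (by omega) (hmin i (by omega)) h1 h2
          have h5 := (hρ.copy i h3 (hmin i (by omega))).2
          rw [M.stackSeq_add_four, ← h4, ← h5]
          congr 1
      rw [hv] at hb
      exact ⟨hv, hb.eq_head?⟩
  exact ⟨trAt ρ, T, J, hJT, ⟨trAt_zero h0, fun j hj => hchain j (by omega),
    fun j hj => (hval j hj).2.symm⟩, hJs, hJc, hTh⟩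

/-! ### From computations to runs of the automaton -/

/-- The stack that the block `b` of a transition represents. -/
def blockStack : StackAct → Fin 6 → List Γ' → List Γ'
  | .keep, _, w => w
  | .pop, b, w => if b = 5 then w.tail else w
  | .push a, b, w => if b = 0 then w else a :: w

theorem blockStack_zero (a : StackAct) (w : List Γ') : blockStack a 0 w = w := by
  cases a <;> simp [blockStack]

theorem blockStack_five (a : StackAct) (w : List Γ') : blockStack a 5 w = a.app w := by
  cases a <;> simp [blockStack, StackAct.app]

theorem blockStack_link {a : StackAct} {b b' : Fin 6} (h : ActLink a b)
    (hb : b'.val = b.val + 1) (w : List Γ') : blockStack a b' w = blockStack a b w := by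
  have h5 : ∀ x : Fin 6, x = 5 ↔ x.val = 5 := fun x => Fin.ext_iff
  have h4 : ∀ x : Fin 6, x = 4 ↔ x.val = 4 := fun x => Fin.ext_iff
  have h0 : ∀ x : Fin 6, x = 0 ↔ x.val = 0 := fun x => Fin.ext_iff
  cases a with
  | keep => rfl
  | pop =>
    simp only [ActLink, ne_eq, h4, h5] at h
    simp only [blockStack, h5]
    rw [if_neg (by omega), if_neg (by omega)]
  | push x =>
    simp only [ActLink, ne_eq, h0, h5] at h
    simp only [blockStack, h0]
    rw [if_neg (by omega), if_neg (by omega)]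

section Construction

variable (e : ℕ → M.E)

/-- The duration of the first part of a block. -/
noncomputable def blockVal (i : ℕ) : ℝ≥0 :=
  ⟨value (blockStack (M.act (e (i / 6))) ⟨i % 6, Nat.mod_lt _ (by norm_num)⟩
    (M.stackSeq e (i / 6))), value_nonneg _⟩

theorem blockVal_eq (j : ℕ) (b : Fin 6) :
    (blockVal e (6 * j + b) : ℝ) = value (blockStack (M.act (e j)) b (M.stackSeq e j)) := by
  have h1 : (6 * j + b.val) / 6 = j := by omega
  have h2 : (⟨(6 * j + b.val) % 6, Nat.mod_lt _ (by norm_num)⟩ : Fin 6) = b :=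
    Fin.ext (by simp only; omega)
  change value _ = _
  rw [h1, h2]

/-- The states of the simulating run. -/
noncomputable def simState (k : ℕ) : M.auto.State :=
  M.system.mkState (e (k / 12), ⟨k / 2 % 6, Nat.mod_lt _ (by norm_num)⟩, decide (k % 2 = 1))
    fun _ => if k % 2 = 1 then blockVal e (k / 2) else 0

/-- The delays of the simulating run. -/
noncomputable def simDelay (k : ℕ) : ℝ≥0 :=
  if k % 2 = 1 then 5 - blockVal e (k / 2) else blockVal e (k / 2)

theorem simState_even (j : ℕ) (b : Fin 6) :
    simState e (2 * (6 * j + b)) = M.system.mkState (e j, b, false) fun _ => 0 := by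
  have h1 : 2 * (6 * j + b.val) / 12 = j := by omega
  have h2 : (⟨2 * (6 * j + b.val) / 2 % 6, Nat.mod_lt _ (by norm_num)⟩ : Fin 6) = b :=
    Fin.ext (by simp only; omega)
  have h3 : ¬ 2 * (6 * j + b.val) % 2 = 1 := by omega
  simp only [simState, h1, h2, h3, if_false, decide_false]

theorem simState_odd (j : ℕ) (b : Fin 6) :
    simState e (2 * (6 * j + b) + 1) =
      M.system.mkState (e j, b, true) fun _ => blockVal e (6 * j + b) := by
  have h1 : (2 * (6 * j + b.val) + 1) / 12 = j := by omega
  have h2 : (⟨(2 * (6 * j + b.val) + 1) / 2 % 6, Nat.mod_lt _ (by norm_num)⟩ : Fin 6) = b :=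
    Fin.ext (by simp only; omega)
  have h3 : (2 * (6 * j + b.val) + 1) % 2 = 1 := by omega
  have h4 : (2 * (6 * j + b.val) + 1) / 2 = 6 * j + b.val := by omega
  simp only [simState, h1, h2, h3, if_true, decide_true]
  rw [h4]

variable {e}

theorem simStep (he : ∀ T, M.IsComp e T) (k : ℕ) :
    ∃ d, M.auto.MixedMove (simState e k) (simDelay e k) d (simState e (k + 1)) := by
  rcases Nat.even_or_odd' k with ⟨i, rfl | rfl⟩ <;> obtain ⟨j, b, rfl⟩ := exists_block i
  · have hd : simDelay e (2 * (6 * j + b)) = blockVal e (6 * j + b) := by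
      rw [simDelay, if_neg (by omega), Nat.mul_div_cancel_left _ two_pos]
    have hv : Val.delay (fun _ : Fin 1 => (0 : ℝ≥0)) (blockVal e (6 * j + b)) =
        fun _ => blockVal e (6 * j + b) := by
      funext x; simp [Val.delay]
    rw [simState_odd, simState_even, hd]
    have h := mixedMove_fst (M := M)
      (s := M.system.mkState (e j, b, false) fun _ => 0) (e := e j) (b := b)
      (M.system.locOf_mkState _ _) (t := blockVal e (6 * j + b)) ?_
    · rw [LocSystem.val_mkState, hv] at h
      exact ⟨_, h⟩
    · rw [LocSystem.val_mkState, hv]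
      simp only [blockVal_eq]
      split_ifs with hb
      · rw [hb, blockStack_zero, ← (he (j + 1)).2.2 j (by omega)]
        exact topBound_value _
      · exact value_lt _
  · have hd : simDelay e (2 * (6 * j + b) + 1) = 5 - blockVal e (6 * j + b) := by
      rw [simDelay, if_pos (by omega), show (2 * (6 * j + b.val) + 1) / 2 = 6 * j + b by omega]
    have hle : blockVal e (6 * j + b) ≤ 5 := by
      rw [← NNReal.coe_le_coe, blockVal_eq]
      exact (value_lt _).le
    rw [simState_odd, hd]
    have hmove := fun (e' : M.E) (b' : Fin 6) (h : M.succ (e j, b, true) (e', b', false)) =>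
      mixedMove_snd (M := M)
        (s := M.system.mkState (e j, b, true) fun _ => blockVal e (6 * j + b))
        (M.system.locOf_mkState _ _) hle h
    by_cases hb : b = 5
    · subst hb
      have h := simState_even e (j + 1) 0
      rw [show 2 * (6 * j + (5 : Fin 6).val) + 1 + 1 = 2 * (6 * (j + 1) + (0 : Fin 6).val) from rfl, h]
      exact ⟨_, hmove _ _ (Or.inr ⟨rfl, rfl, rfl, (he (j + 1)).2.1 j (by omega)⟩)⟩
    · have hb5 : b.val ≠ 5 := fun h => hb (Fin.ext h)
      have h := simState_even e j ⟨b.val + 1, by omega⟩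
      rw [show 2 * (6 * j + b.val) + 1 + 1 = 2 * (6 * j + (b.val + 1)) by ring, h]
      exact ⟨_, hmove _ _ (Or.inl ⟨rfl, rfl, rfl⟩)⟩

theorem modelChecks_of_comp (he : ∀ T, M.IsComp e T) {T J : ℕ} (hT : M.src (e T) = M.halt)
    (hJ : M.IsStart (e J)) (hJ0 : 0 < J) : ModelChecks M.auto (haltFormula (30 * J)) := by
  choose d hd using simStep he
  -- Obligations arise only before step `T` and reach at most four steps ahead; the run must also
  -- contain step `J`. The length leaves room for both.
  let ρ : M.auto.Run := ⟨12 * (T + J + 6), simState e, simDelay e, d, fun k _ => hd k⟩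
  have hlen : ρ.length = 12 * (T + J + 6) := rfl
  have h0 : ρ.state 0 = M.auto.initState := by
    have h := simState_even e 0 0
    rw [(he 0).1] at h
    exact h
  have htr : ∀ j, trAt ρ j = e j := by
    intro j
    have h := simState_even e j 0
    rw [show 2 * (6 * j + (0 : Fin 6).val) = 12 * j by rw [Fin.val_zero]; ring] at h
    rw [trAt, show ρ.state (12 * j) = _ from h, LocSystem.locOf_mkState]
  have hdur : ∀ (j : ℕ) (b : Fin 6),
      dur ρ (6 * j + b) = value (blockStack (M.act (e j)) b (M.stackSeq e j)) := by
    intro j b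
    rw [← blockVal_eq, dur]
    change (simDelay e _ : ℝ) = _
    rw [simDelay, if_neg (by omega), Nat.mul_div_cancel_left _ two_pos]
  have hlt : ∀ j, M.src (e j) ≠ M.halt → j < T := by
    intro j hj
    by_contra hle
    exact hj (src_eq_halt_of_le hT (not_lt.1 hle) fun i hi => (he (i + 1)).2.1 i (by omega))
  refine ⟨ρ, h0, (sat_haltFormula_iff h0 _).2 ⟨⟨?_, ?_, ?_⟩, ?_, ?_⟩⟩
  · intro j b hl hh ha
    rw [htr] at hh ha
    have := hlt j hh
    have hb5 : b.val ≠ 5 := by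
      intro h
      have : b = 5 := Fin.ext h
      subst this
      revert ha
      cases M.act (e j) <;> simp [ActLink]
    refine ⟨by omega, ?_⟩
    have h1 := hdur j ⟨b.val + 1, by omega⟩
    rw [blockStack_link ha rfl, ← hdur] at h1
    exact h1
  · intro j hl hh
    rw [htr] at hh
    have := hlt j hh
    refine ⟨by omega, ?_⟩
    have h1 := hdur (j + 4) 0
    have h2 := hdur j 5
    rw [blockStack_zero, M.stackSeq_add_four] at h1
    rw [blockStack_five, ← h1] at h2
    exact h2.symm
  · intro j hl hh
    rw [htr] at hh
    have := hlt j hh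
    refine ⟨by omega, ?_⟩
    rw [acc_zero_cell h0 (by omega), htr]
    have d0 : dur ρ (6 * j) = _ := hdur j 0
    have d1 : dur ρ (6 * j + 1) = _ := hdur j 1
    have d2 : dur ρ (6 * j + 2) = _ := hdur j 2
    have d3 : dur ρ (6 * j + 3) = _ := hdur j 3
    have d4 : dur ρ (6 * j + 4) = _ := hdur j 4
    have d5 : dur ρ (6 * j + 5) = _ := hdur j 5
    rw [d0, d1, d2, d3, d4, d5]
    have ho := (he (j + 1)).2.2 j (by omega)
    cases ha : M.act (e j) with
    | keep => simp
    | pop =>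
      have hne := M.obs_of_pop _ ha
      rw [← ho] at hne ⊢
      cases hw : M.stackSeq e j with
      | nil => simp [hw] at hne
      | cons x w =>
        simp [blockStack, obsDig, value]
        ring
    | push x =>
      simp [blockStack, value]
      ring
  · exact ⟨2 * (6 * T + (0 : Fin 6).val) + 1, by omega, by simp only [Fin.val_zero]; omega,
      (at_odd_iff h0 0 (by norm_num) (by simp only [Fin.val_zero]; omega)).2 (by rw [htr]; exact hT)⟩
  · refine ⟨2 * (6 * J + (0 : Fin 6).val), by omega, by simp only [Fin.val_zero]; omega,
      (at_even_iff h0 0 (by norm_num) (by simp only [Fin.val_zero]; omega)).2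
        ⟨rfl, rfl, by rw [htr]; exact hJ⟩, ?_⟩
    rw [acc_one_even h0 (by simp only [Fin.val_zero]; omega)]
    push_cast
    simp only [Fin.val_zero, Nat.cast_zero]
    ring

end Construction

end CyclicMachine

end PricedTimed

namespace PricedTimed

/-! ### Simulation of the stack machines of partial recursive functions -/

namespace StackSim

open Turing Turing.PartrecToTM2 StateTransition Relation Function
open Turing.ToPartrec (Code)

/-- Statements of the stack machine. -/
abbrev Stm : Type := TM2.Stmt (fun _ : K' => Γ') Λ' (Option Γ')

/-- The cyclic order of the stacks. -/
def nxt : K' → K'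
  | .main => .rev
  | .rev => .aux
  | .aux => .stack
  | .stack => .main

/-- The stack that is treated in the `j`-th step. -/
def ptr : ℕ → K'
  | 0 => .main
  | j + 1 => nxt (ptr j)

theorem nxt_iterate_four (i : K') : nxt (nxt (nxt (nxt i))) = i := by cases i <;> rfl

theorem ptr_add_four (j : ℕ) : ptr (j + 4) = ptr j := nxt_iterate_four _

theorem ptr_ne (j r : ℕ) (hr : r < 3) : ptr (j + 1 + r) ≠ ptr j := by
  interval_cases r <;> simp only [ptr] <;> cases ptr j <;> decide

theorem ptr_four_mul (n : ℕ) : ptr (4 * n) = .main := by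
  induction n with
  | zero => rfl
  | succ n ih => rw [show 4 * (n + 1) = 4 * n + 4 by ring, ptr_add_four, ih]

/-- The operation on the stack `i` with top symbol `o`, the next statement and the next value of
the local variable. -/
def ctl : Option Stm → Option Γ' → K' → Option Γ' → StackAct × Option Stm × Option Γ'
  | none, s, _, _ => (.keep, none, s)
  | some (.push k f q), s, i, _ =>
      if i = k then (.push (f s), some q, s) else (.keep, some (.push k f q), s)
  | some (.peek k f q), s, i, o =>
      if i = k then (.keep, some q, f s o) else (.keep, some (.peek k f q), s)
  | some (.pop k f q), s, i, o =>
      -- Popping an empty stack changes nothing and becomes `keep`, so a genuine pop always observes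
      -- a symbol.
      if i = k then (if o = none then .keep else .pop, some q, f s o)
      else (.keep, some (.pop k f q), s)
  | some (.load a q), s, _, _ => (.keep, some q, a s)
  | some (.branch p q₁ q₂), s, _, _ => (.keep, some (cond (p s) q₁ q₂), s)
  | some (.goto l), s, _, _ => (.keep, some (tr (l s)), s)
  | some .halt, s, _, _ => (.keep, none, s)

/-- Configurations of the simulation. -/
structure SimCfg where
  stm : Option Stm
  var : Option Γ'
  stk : K' → List Γ'
  pos : K'

/-- One step of the simulation. -/
def simNext (c : SimCfg) : SimCfg :=
  let r := ctl c.stm c.var c.pos (c.stk c.pos).head?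
  ⟨r.2.1, r.2.2, update c.stk c.pos (r.1.app (c.stk c.pos)), nxt c.pos⟩

/-- One step of the simulation, undefined at the end. -/
def simStep (c : SimCfg) : Option SimCfg :=
  match c.stm with
  | none => none
  | some _ => some (simNext c)

theorem simStep_some (q : Stm) (s : Option Γ') (S : K' → List Γ') (i : K') :
    simStep ⟨some q, s, S, i⟩ = some (simNext ⟨some q, s, S, i⟩) := rfl

/-- At most three idle steps bring the turn to stack `k`. -/
theorem reaches_wait {q : Stm} {k : K'} {s : Option Γ'} {S : K' → List Γ'}
    (h : ∀ i o, i ≠ k → ctl (some q) s i o = (.keep, some q, s)) (i : K') :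
    Reaches simStep ⟨some q, s, S, i⟩ ⟨some q, s, S, k⟩ := by
  have step : ∀ i, i ≠ k → (⟨some q, s, S, nxt i⟩ : SimCfg) ∈ simStep ⟨some q, s, S, i⟩ := by
    intro i hi
    rw [simStep_some, simNext]
    simp only [h i _ hi, StackAct.app, update_eq_self, Option.mem_def]
  have last : ∀ i k : K', i ≠ k → nxt i ≠ k → nxt (nxt i) ≠ k → nxt (nxt (nxt i)) = k := by
    intro i k
    cases i <;> cases k <;> simp [nxt]
  by_cases h1 : i = k
  · rw [h1]; exact ReflTransGen.refl
  refine ReflTransGen.head (step _ h1) ?_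
  by_cases h2 : nxt i = k
  · rw [h2]
  refine ReflTransGen.head (step _ h2) ?_
  by_cases h3 : nxt (nxt i) = k
  · rw [h3]
  refine ReflTransGen.head (step _ h3) ?_
  rw [last i k h1 h2 h3]

/-- One step of the original machine executes a whole statement; here each elementary operation is a
separate step, preceded by waiting if it accesses a stack. -/
theorem reaches_stepAux (q : Stm) : ∀ (s : Option Γ') (S : K' → List Γ') (i : K'), ∃ i',
    Reaches₁ simStep ⟨some q, s, S, i⟩
      ⟨(TM2.stepAux q s S).l.map tr, (TM2.stepAux q s S).var, (TM2.stepAux q s S).stk, i'⟩ := by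
  induction q with
  | push k f q ih =>
    intro s S i
    obtain ⟨i', h⟩ := ih s (update S k (f s :: S k)) (nxt k)
    refine ⟨i', TransGen.trans_right
      (reaches_wait (k := k) (fun i o hi => by simp [ctl, hi]) i) (TransGen.head ?_ h)⟩
    rw [simStep_some, simNext]
    simp [ctl, StackAct.app]
  | peek k f q ih =>
    intro s S i
    obtain ⟨i', h⟩ := ih (f s (S k).head?) S (nxt k)
    refine ⟨i', TransGen.trans_right
      (reaches_wait (k := k) (fun i o hi => by simp [ctl, hi]) i) (TransGen.head ?_ h)⟩
    rw [simStep_some, simNext]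
    simp [ctl, StackAct.app]
  | pop k f q ih =>
    intro s S i
    obtain ⟨i', h⟩ := ih (f s (S k).head?) (update S k (S k).tail) (nxt k)
    refine ⟨i', TransGen.trans_right
      (reaches_wait (k := k) (fun i o hi => by simp [ctl, hi]) i) (TransGen.head ?_ h)⟩
    rw [simStep_some, simNext]
    cases hS : S k <;> simp [ctl, StackAct.app, hS]
  | load a q ih =>
    intro s S i
    obtain ⟨i', h⟩ := ih (a s) S (nxt i)
    refine ⟨i', TransGen.head ?_ h⟩
    rw [simStep_some, simNext]
    simp [ctl, StackAct.app]
  | branch p q₁ q₂ ih₁ ih₂ =>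
    intro s S i
    have key : (⟨some (cond (p s) q₁ q₂), s, S, nxt i⟩ : SimCfg) ∈
        simStep ⟨some (.branch p q₁ q₂), s, S, i⟩ := by
      rw [simStep_some, simNext]
      simp [ctl, StackAct.app]
    cases hp : p s
    · obtain ⟨i', h⟩ := ih₂ s S (nxt i)
      rw [hp] at key
      refine ⟨i', TransGen.head key ?_⟩
      rw [TM2.stepAux, hp]
      exact h
    · obtain ⟨i', h⟩ := ih₁ s S (nxt i)
      rw [hp] at key
      refine ⟨i', TransGen.head key ?_⟩
      rw [TM2.stepAux, hp]
      exact h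
  | goto l =>
    intro s S i
    refine ⟨nxt i, TransGen.single ?_⟩
    rw [simStep_some, simNext]
    simp only [ctl, StackAct.app, update_eq_self]
    rfl
  | halt =>
    intro s S i
    refine ⟨nxt i, TransGen.single ?_⟩
    rw [simStep_some, simNext]
    simp only [ctl, StackAct.app, update_eq_self]
    rfl

/-- The relation ignores whose turn it is, because waiting makes every position of the pointer
equally good. -/
theorem respects_simStep : Respects (TM2.step tr) simStep
    fun (a : TM2.Cfg (fun _ : K' => Γ') Λ' (Option Γ')) (b : SimCfg) =>
      b.stm = a.l.map tr ∧ b.var = a.var ∧ b.stk = a.stk := by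
  rintro ⟨_ | l, s, S⟩ ⟨q, s', S', i⟩ ⟨hq, hs, hS⟩ <;> dsimp only at hq hs hS <;> subst hq hs hS
  · rfl
  · obtain ⟨i', h⟩ := reaches_stepAux (tr l) s' S' i
    exact ⟨_, ⟨rfl, rfl, rfl⟩, h⟩

theorem eval_simStep_dom_iff (c : SimCfg) :
    (eval simStep c).Dom ↔ ∃ m, (simNext^[m] c).stm = none := by
  constructor
  · intro h
    obtain ⟨h1, h2⟩ := mem_eval.1 (Part.get_mem h)
    generalize (eval simStep c).get h = b at h1 h2
    induction h1 using ReflTransGen.head_induction_on with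
    | refl =>
      refine ⟨0, ?_⟩
      cases hb : b.stm with
      | none => exact hb
      | some q => rw [simStep, hb] at h2; simp at h2
    | @head a a' hab hb ih =>
      have ha : a' = simNext a := by
        rw [simStep] at hab
        cases hq : a.stm with
        | none => rw [hq] at hab; simp at hab
        | some q => rw [hq] at hab; exact (Option.some.inj hab).symm
      subst ha
      obtain ⟨m, hm⟩ := ih (Part.dom_iff_mem.2 ⟨b, mem_eval.2 ⟨hb, h2⟩⟩)
      exact ⟨m + 1, hm⟩
  · rintro ⟨m, hm⟩
    induction m generalizing c with
    | zero =>
      have h : simStep c = none := by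
        rw [simStep, show c.stm = none from hm]
      exact Part.dom_iff_mem.2 ⟨c, mem_eval.2 ⟨ReflTransGen.refl, h⟩⟩
    | succ m ih =>
      cases hq : c.stm with
      | none =>
        have h : simStep c = none := by rw [simStep, hq]
        exact Part.dom_iff_mem.2 ⟨c, mem_eval.2 ⟨ReflTransGen.refl, h⟩⟩
      | some q =>
        have h : simStep c = some (simNext c) := by rw [simStep, hq]
        rw [reaches_eval (ReflTransGen.single h)]
        exact ih _ hm

/-- The configuration in which the simulation starts. -/
def simInit (c : Code) (w : List Γ') : SimCfg :=
  -- Loading ends with a step on `main`, so the turn is at `rev`.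
  ⟨some (tr (trNormal c .halt)), none, K'.elim w [] [] [], .rev⟩

theorem exists_halt_iff (c : Code) (v : List ℕ) :
    (∃ m, (simNext^[m] (simInit c (trList v))).stm = none) ↔ (c.eval v).Dom := by
  rw [← eval_simStep_dom_iff,
    tr_eval_dom respects_simStep (a₁ := PartrecToTM2.init c v) ⟨rfl, rfl, rfl⟩,
    show eval (TM2.step tr) (PartrecToTM2.init c v) = _ from PartrecToTM2.tr_eval c v]
  rfl

/-- Numbers of this form have a unary-looking code, which a loop pushing a single symbol can
produce. -/
theorem trNat_two_pow_sub_one (n : ℕ) : trNat (2 ^ n - 1) = List.replicate n Γ'.bit1 := by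
  induction n with
  | zero => simp
  | succ n ih =>
    have h1 : 2 ^ (n + 1) - 1 = Nat.bit true (2 ^ n - 1) := by
      have := Nat.one_le_two_pow (n := n)
      rw [Nat.bit_val, pow_succ, Bool.toNat_true]; omega
    have h2 : ∀ x : Num, trNum (Num.bit1 x) = Γ'.bit1 :: trNum x := by rintro (_ | x) <;> rfl
    rw [trNat, h1, ← Num.ofNat'_eq, Num.ofNat'_bit, cond_true, h2, Num.ofNat'_eq, ← trNat, ih]
    rfl

theorem trList_two_pow_sub_one (n : ℕ) :
    trList [2 ^ n - 1] = List.replicate n Γ'.bit1 ++ [Γ'.cons] := by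
  rw [trList, trNat_two_pow_sub_one, trList]

end StackSim

end PricedTimed

namespace PricedTimed

namespace StackSim

open Turing Turing.PartrecToTM2 StateTransition Relation Function
open Turing.ToPartrec (Code)

instance : Fintype K' := ⟨{.main, .rev, .aux, .stack}, fun k => by cases k <;> simp⟩

/-! ### The cyclic machine of a program -/

/-- The statements that occur in the stack machine of a program. -/
noncomputable def stms (c : Code) : Finset (Option Stm) := TM2.stmts tr (codeSupp c .halt)

theorem mem_stms_of_mem {c : Code} {l : Λ'} (hl : l ∈ codeSupp c .halt) :
    some (tr l) ∈ stms c := by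
  classical
  exact Finset.some_mem_insertNone.2 (Finset.mem_biUnion.2 ⟨l, hl, TM2.stmts₁_self⟩)

theorem none_mem_stms (c : Code) : none ∈ stms c := by
  simp [stms, TM2.stmts]

theorem init_mem_stms (c : Code) : some (tr (trNormal c .halt)) ∈ stms c :=
  mem_stms_of_mem (tr_supports c .halt).1

/-- The control never leaves this finite set, so finitely many transitions suffice. For `goto` this
is the support property of the program. -/
theorem ctl_mem_stms {c : Code} {q : Option Stm} (hq : q ∈ stms c) (s : Option Γ') (i : K')
    (o : Option Γ') : (ctl q s i o).2.1 ∈ stms c := by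
  have sub : ∀ {q₁ q₂ : Stm}, q₁ ∈ TM2.stmts₁ q₂ → some q₂ ∈ stms c → some q₁ ∈ stms c :=
    fun h => TM2.stmts_trans h
  rcases q with _ | q
  · exact hq
  cases q with
  | push k f q =>
    simp only [ctl]
    split_ifs
    · exact sub (by simp [TM2.stmts₁, TM2.stmts₁_self]) hq
    · exact hq
  | peek k f q =>
    simp only [ctl]
    split_ifs
    · exact sub (by simp [TM2.stmts₁, TM2.stmts₁_self]) hq
    · exact hq
  | pop k f q =>
    simp only [ctl]
    by_cases h : i = k
    · rw [if_pos h]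
      exact sub (by simp [TM2.stmts₁, TM2.stmts₁_self]) hq
    · rw [if_neg h]
      exact hq
  | load a q => exact sub (by simp [TM2.stmts₁, TM2.stmts₁_self]) hq
  | branch p q₁ q₂ =>
    simp only [ctl]
    cases p s
    · exact sub (by simp [TM2.stmts₁, TM2.stmts₁_self]) hq
    · exact sub (by simp [TM2.stmts₁, TM2.stmts₁_self]) hq
  | goto l =>
    have h := @TM2.stmts_supportsStmt _ _ _ _ ⟨trNormal c .halt⟩ _ _ _ (tr_supports c .halt) hq
    exact mem_stms_of_mem (h s)
  | halt => exact none_mem_stms c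

theorem ctl_eq_pop {q : Option Stm} {s : Option Γ'} {i : K'} {o : Option Γ'}
    (h : (ctl q s i o).1 = .pop) : o ≠ none := by
  rcases q with _ | q
  · simp [ctl] at h
  cases q <;> simp only [ctl] at h <;> (try split_ifs at h) <;> first | assumption | simp at h

/-- Control states. -/
inductive Ctrl where
  | ini (i : K')
  | load (i : K')
  | sim (q : Stm) (s : Option Γ') (i : K')
  | halt

/-- The control state of a configuration of the simulation. -/
def Ctrl.mk : Option Stm → Option Γ' → K' → Ctrl
  | none, _, _ => .halt
  | some q, s, i => .sim q s i

/-- Transitions: initialization of the stkAt, a loop that loads the input, and the simulation. -/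
inductive Trans (X : Finset (Option Stm)) where
  | ini (i : K')
  | load (i : K') (o : Option Γ')
  | exit (o : Option Γ')
  | sim (q : X) (s : Option Γ') (i : K') (o : Option Γ')

namespace Trans

variable {X : Finset (Option Stm)}

/-- Transitions as elements of a sum type. -/
def toSum : Trans X → K' ⊕ (K' × Option Γ') ⊕ Option Γ' ⊕ (X × Option Γ' × K' × Option Γ')
  | .ini i => .inl i
  | .load i o => .inr (.inl (i, o))
  | .exit o => .inr (.inr (.inl o))
  | .sim q s i o => .inr (.inr (.inr (q, s, i, o)))

theorem toSum_injective : Injective (toSum (X := X)) := by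
  rintro (_ | _ | _ | _) (_ | _ | _ | _) h <;> simp_all [toSum]

noncomputable instance : Fintype (Trans X) := Fintype.ofInjective _ toSum_injective

/-- The source of a transition. -/
def src : Trans X → Ctrl
  | .ini i => .ini i
  | .load i _ => .load i
  | .exit _ => .load .main
  | .sim q s i _ => .mk q s i

/-- The symbol observed by a transition. -/
def obs : Trans X → Option Γ'
  | .ini _ => none
  | .load _ o => o
  | .exit o => o
  | .sim _ _ _ o => o

/-- The operation of a transition. -/
def act : Trans X → StackAct
  -- The input is built from the bottom, so its terminator is pushed first.
  | .ini i => if i = .main then .push .cons else .keep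
  | .load i _ => if i = .main then .push .bit1 else .keep
  | .exit _ => .keep
  | .sim q s i o => (ctl q s i o).1

/-- The target of a transition, if the simulation starts with the statement `q₀`. -/
def tgt (q₀ : Stm) : Trans X → Ctrl
  | .ini i => if i = .stack then .load .main else .ini (nxt i)
  | .load i _ => .load (nxt i)
  | .exit _ => .sim q₀ none .rev
  | .sim q s i o => .mk (ctl q s i o).2.1 (ctl q s i o).2.2 (nxt i)

/-- The transition into the simulation. -/
def IsExit (e : Trans X) : Prop := ∃ o, e = .exit o

theorem eq_ini_of_src {e : Trans X} {i : K'} (h : e.src = .ini i) : e = .ini i := by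
  rcases e with i' | ⟨i', o⟩ | o | ⟨⟨_ | q, hq⟩, s, i', o⟩
  · exact congrArg Trans.ini (Ctrl.ini.inj h)
  all_goals exact Ctrl.noConfusion h

theorem eq_sim_of_src {e : Trans X} {q : Stm} {s : Option Γ'} {i : K'} (h : e.src = .sim q s i) :
    ∃ (hq : some q ∈ X) (o : Option Γ'), e = .sim ⟨some q, hq⟩ s i o := by
  rcases e with i' | ⟨i', o⟩ | o | ⟨⟨_ | q', hq⟩, s', i', o⟩
  case sim.some =>
    obtain ⟨rfl, rfl, rfl⟩ := Ctrl.sim.inj h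
    exact ⟨hq, o, rfl⟩
  all_goals exact Ctrl.noConfusion h

end Trans

theorem src_of_chain {X : Finset (Option Stm)} {q₀ : Stm} {e : ℕ → Trans X} (j : ℕ) (hj : j < 4)
    (h0 : e 0 = .ini .main) (h : ∀ i < j, (e (i + 1)).src = (e i).tgt q₀) : e j = .ini (ptr j) := by
  induction j with
  | zero => exact h0
  | succ j ih =>
    refine Trans.eq_ini_of_src ?_
    rw [h j (by omega), ih (by omega) fun i hi => h i (by omega)]
    have hj3 : j < 3 := by omega
    clear ih h
    interval_cases j <;> simp [Trans.tgt, ptr, nxt]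

/-- The cyclic machine that guesses a number of the form `2 ^ n - 1` and runs a program on it. -/
noncomputable def machine (c : Code) : CyclicMachine where
  E := Trans (stms c)
  P := Ctrl
  src := Trans.src
  tgt := Trans.tgt (tr (trNormal c .halt))
  obs := Trans.obs
  act := Trans.act
  first := .ini .main
  halt := .halt
  IsStart := Trans.IsExit
  exists_next := by
    rintro (i | ⟨i, o⟩ | o | ⟨⟨q, hq⟩, s, i, o⟩)
    · by_cases hi : i = .stack
      · exact ⟨.load .main none, by simp [Trans.src, Trans.tgt, hi]⟩
      · exact ⟨.ini (nxt i), by simp [Trans.src, Trans.tgt, hi]⟩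
    · exact ⟨.load (nxt i) none, rfl⟩
    · exact ⟨.sim ⟨_, init_mem_stms c⟩ none .rev none, rfl⟩
    · exact ⟨.sim ⟨_, ctl_mem_stms hq s i o⟩ _ (nxt i) none, rfl⟩
  tgt_of_src_halt := by
    rintro (i | ⟨i, o⟩ | o | ⟨⟨_ | q, hq⟩, s, i, o⟩) h
    case sim.none => rfl
    all_goals exact Ctrl.noConfusion h
  src_ne_halt_of_isStart := by
    rintro _ ⟨o, rfl⟩ h
    exact Ctrl.noConfusion h
  obs_of_pop := by
    rintro (i | ⟨i, o⟩ | o | ⟨⟨q, hq⟩, s, i, o⟩) h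
    · simp only [Trans.act] at h; split_ifs at h
    · simp only [Trans.act] at h; split_ifs at h
    · simp [Trans.act] at h
    · exact ctl_eq_pop h
  obs_initial := by
    intro e j hj h0 h
    rw [src_of_chain j hj h0 h]
    rfl

/-! ### Computations of the machine compared with the simulated program -/

variable {c : Code}

/-- The contents of the stacks before the `j`-th step. -/
noncomputable def stkAt (e : ℕ → (machine c).E) : ℕ → K' → List Γ'
  | 0 => fun _ => []
  | j + 1 => update (stkAt e j) (ptr j) (((machine c).act (e j)).app (stkAt e j (ptr j)))

/-- A stack does not change during the three steps that treat the others, so the next four entries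
of the queue are the current contents of the four stacks. -/
theorem stkAt_ptr_add (e : ℕ → (machine c).E) (j : ℕ) :
    ∀ r < 4, stkAt e j (ptr (j + r)) = (machine c).stackSeq e (j + r) := by
  induction j with
  | zero =>
    intro r hr
    rw [CyclicMachine.stackSeq_of_lt _ _ (by omega)]
    rfl
  | succ j ih =>
    intro r hr
    rw [stkAt]
    by_cases hr3 : r < 3
    · rw [update_of_ne (ptr_ne j r hr3), show j + 1 + r = j + (1 + r) by ring]
      exact ih _ (by omega)
    · obtain rfl : r = 3 := by omega
      rw [show j + 1 + 3 = j + 4 by ring, ptr_add_four, update_self,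
        CyclicMachine.stackSeq_add_four,
        show stkAt e j (ptr j) = _ from ih 0 (by norm_num)]
      rfl

theorem stkAt_ptr (e : ℕ → (machine c).E) (j : ℕ) :
    stkAt e j (ptr j) = (machine c).stackSeq e j := stkAt_ptr_add e j 0 (by norm_num)

/-- The contents of the stacks while the input is loaded. -/
def loadStk (j : ℕ) : K' → List Γ' :=
  K'.elim (if j = 0 then [] else List.replicate ((j - 1) / 4) .bit1 ++ [.cons]) [] [] []

theorem loadStk_succ (j : ℕ) : loadStk (j + 1) = update (loadStk j) (ptr j)
    ((if ptr j = .main then (if j < 4 then .push .cons else .push .bit1) else .keep : StackAct).app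
      (loadStk j (ptr j))) := by
  obtain ⟨n, r, hr, rfl⟩ : ∃ n r, r < 4 ∧ j = 4 * n + r :=
    ⟨j / 4, j % 4, Nat.mod_lt _ (by norm_num), by omega⟩
  have h0 := ptr_four_mul n
  have hp : ∀ r, r = 1 ∨ r = 2 ∨ r = 3 → ptr (4 * n + r) ≠ .main ∧
      loadStk (4 * n + r + 1) = loadStk (4 * n + r) := by
    rintro r hr
    constructor
    · rcases hr with rfl | rfl | rfl <;> simp only [ptr, h0] <;> decide
    · rw [loadStk, loadStk, if_neg (by omega), if_neg (by omega),
        show (4 * n + r + 1 - 1) / 4 = (4 * n + r - 1) / 4 by omega]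
  by_cases hr0 : r = 0
  · subst hr0
    rw [add_zero, h0, if_pos rfl, loadStk, if_neg (by omega), loadStk, K'.elim_update_main]
    congr 1
    by_cases hn : n = 0
    · subst hn; simp [StackAct.app]
    · rw [if_neg (by omega), if_neg (by omega), K'.elim_main,
        show (4 * n + 1 - 1) / 4 = (4 * n - 1) / 4 + 1 by omega]
      rfl
  · obtain ⟨h1, h2⟩ := hp r (by omega)
    rw [if_neg h1, h2]
    simp [StackAct.app]

theorem loadStk_end (n : ℕ) : loadStk (4 * n + 4) = K'.elim (trList [2 ^ n - 1]) [] [] [] := by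
  rw [loadStk, if_neg (by omega), trList_two_pow_sub_one, show (4 * n + 4 - 1) / 4 = n by omega]

/-- The configurations of the simulation on input `2 ^ n - 1`. -/
def simSeq (c : Code) (n m : ℕ) : SimCfg := simNext^[m] (simInit c (trList [2 ^ n - 1]))

theorem simSeq_succ (n m : ℕ) : simSeq c n (m + 1) = simNext (simSeq c n m) :=
  iterate_succ_apply' _ _ _

theorem simSeq_stm_mem (n m : ℕ) : (simSeq c n m).stm ∈ stms c := by
  induction m with
  | zero => exact init_mem_stms c
  | succ m ih => rw [simSeq_succ]; exact ctl_mem_stms ih _ _ _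

theorem simSeq_pos (n m : ℕ) : (simSeq c n m).pos = ptr (4 * n + 5 + m) := by
  induction m with
  | zero =>
    rw [add_zero, show 4 * n + 5 = 4 * n + 4 + 1 from rfl, ptr, ptr_add_four, ptr_four_mul]
    rfl
  | succ m ih =>
    rw [simSeq_succ, ← add_assoc, ptr, ← ih]
    rfl

/-- The control states of the simulation on input `2 ^ n - 1`. -/
def ctrlSeq (c : Code) (n j : ℕ) : Ctrl :=
  if j < 4 then .ini (ptr j) else if j < 4 * n + 5 then .load (ptr j) else
    .mk (simSeq c n (j - (4 * n + 5))).stm (simSeq c n (j - (4 * n + 5))).var (ptr j)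

/-- The stacks of the simulation on input `2 ^ n - 1`. -/
def stkSeq (c : Code) (n j : ℕ) : K' → List Γ' :=
  if j < 4 * n + 5 then loadStk j else (simSeq c n (j - (4 * n + 5))).stk

theorem ctrlSeq_sim (n m : ℕ) : ctrlSeq c n (4 * n + 5 + m) =
    .mk (simSeq c n m).stm (simSeq c n m).var (simSeq c n m).pos := by
  rw [ctrlSeq, if_neg (by omega), if_neg (by omega), Nat.add_sub_cancel_left, simSeq_pos]

theorem stkSeq_sim (n m : ℕ) : stkSeq c n (4 * n + 5 + m) = (simSeq c n m).stk := by
  rw [stkSeq, if_neg (by omega), Nat.add_sub_cancel_left]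

/-- The intended computation: 4 initial steps, 4n loading steps, the exit at step 4n + 4, and step m
of the simulation at 4n + 5 + m. -/
theorem exists_trans (n j : ℕ) : ∃ e : Trans (stms c), e.src = ctrlSeq c n j ∧
    e.tgt (tr (trNormal c .halt)) = ctrlSeq c n (j + 1) ∧ e.obs = (stkSeq c n j (ptr j)).head? ∧
    stkSeq c n (j + 1) = update (stkSeq c n j) (ptr j) (e.act.app (stkSeq c n j (ptr j))) ∧
    (j = 4 * n + 4 → e.IsExit) := by
  rcases lt_or_ge j 4 with h4 | h4
  · refine ⟨.ini (ptr j), ?_, ?_, ?_, ?_, by omega⟩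
    · rw [ctrlSeq, if_pos h4]; rfl
    · interval_cases j <;> simp [ctrlSeq, Trans.tgt, ptr, nxt]
    · rw [stkSeq, if_pos (by omega)]
      interval_cases j <;> simp [loadStk, Trans.obs, ptr, nxt]
    · rw [stkSeq, if_pos (by omega), stkSeq, if_pos (by omega), loadStk_succ]
      simp only [if_pos h4, Trans.act]
  rcases lt_trichotomy j (4 * n + 4) with hj | rfl | hj
  · refine ⟨.load (ptr j) (stkSeq c n j (ptr j)).head?, ?_, ?_, rfl, ?_, by omega⟩
    · rw [ctrlSeq, if_neg (by omega), if_pos (by omega)]; rfl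
    · rw [ctrlSeq, if_neg (by omega), if_pos (by omega)]; rfl
    · rw [stkSeq, if_pos (by omega), stkSeq, if_pos (by omega), loadStk_succ]
      simp only [if_neg (not_lt.2 h4), Trans.act]
  · refine ⟨.exit (stkSeq c n (4 * n + 4) (ptr (4 * n + 4))).head?, ?_, ?_, rfl, ?_,
      fun _ => ⟨_, rfl⟩⟩
    · rw [ctrlSeq, if_neg (by omega), if_pos (by omega), ptr_add_four, ptr_four_mul]; rfl
    · rw [show 4 * n + 4 + 1 = 4 * n + 5 + 0 from rfl, ctrlSeq_sim]; rfl
    · rw [show 4 * n + 4 + 1 = 4 * n + 5 + 0 from rfl, stkSeq_sim, stkSeq, if_pos (by omega),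
        loadStk_end]
      simp only [Trans.act, StackAct.app, update_eq_self]
      rfl
  · obtain ⟨m, rfl⟩ := Nat.exists_eq_add_of_le (show 4 * n + 5 ≤ j from hj)
    refine ⟨.sim ⟨_, simSeq_stm_mem n m⟩ (simSeq c n m).var (simSeq c n m).pos
      ((simSeq c n m).stk (simSeq c n m).pos).head?, ?_, ?_, ?_, ?_, by omega⟩
    · rw [ctrlSeq_sim]; rfl
    · rw [add_assoc _ m, ctrlSeq_sim, simSeq_succ]; rfl
    · rw [stkSeq_sim, ← simSeq_pos (c := c)]; rfl
    · rw [add_assoc _ m, stkSeq_sim, stkSeq_sim, simSeq_succ, ← simSeq_pos (c := c)]; rfl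

theorem exists_comp (n m : ℕ) (hm : (simSeq c n m).stm = none) :
    ∃ e : ℕ → (machine c).E, (∀ T, (machine c).IsComp e T) ∧
      (machine c).src (e (4 * n + 5 + m)) = (machine c).halt ∧
      (machine c).IsStart (e (4 * n + 4)) := by
  have hex : ∀ j, ∃ e : (machine c).E, (machine c).src e = ctrlSeq c n j ∧
      (machine c).tgt e = ctrlSeq c n (j + 1) ∧
      (machine c).obs e = (stkSeq c n j (ptr j)).head? ∧
      stkSeq c n (j + 1) = update (stkSeq c n j) (ptr j)
        (((machine c).act e).app (stkSeq c n j (ptr j))) ∧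
      (j = 4 * n + 4 → (machine c).IsStart e) := exists_trans n
  choose e h1 h2 h3 h4 h5 using hex
  have hst : ∀ j, stkAt e j = stkSeq c n j := by
    intro j
    induction j with
    | zero =>
      funext k
      cases k <;> simp [stkAt, stkSeq, loadStk]
    | succ j ih => rw [stkAt, ih]; exact (h4 j).symm
  refine ⟨e, fun T => ⟨?_, fun j _ => ?_, fun j _ => ?_⟩, ?_, h5 _ rfl⟩
  · exact Trans.eq_ini_of_src (h1 0)
  · exact (h1 (j + 1)).trans (h2 j).symm
  · rw [← stkAt_ptr, hst]; exact (h3 j).symm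
  · refine (h1 _).trans ?_
    rw [ctrlSeq_sim, hm]
    rfl

/-- Control states of the simulation. -/
def Ctrl.IsLate : Ctrl → Prop
  | .ini _ => False
  | .load _ => False
  | .sim _ _ _ => True
  | .halt => True

theorem Ctrl.isLate_mk (q : Option Stm) (s : Option Γ') (i : K') : (Ctrl.mk q s i).IsLate := by
  cases q <;> trivial

theorem isLate_tgt {X : Finset (Option Stm)} {q₀ : Stm} {e : Trans X} (h : e.src.IsLate) :
    (e.tgt q₀).IsLate := by
  rcases e with i | ⟨i, o⟩ | o | ⟨q, s, i, o⟩
  · exact h.elim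
  · exact h.elim
  · exact h.elim
  · exact Ctrl.isLate_mk _ _ _

/-- The choices of the machine are when to leave the loop and which symbol to observe. The first is
fixed by the start transition at 4n + 4, the second by the actual stacks, so the computation must
follow the simulation. -/
theorem exists_halt_of_comp {e : ℕ → (machine c).E} {T n : ℕ} (hn : 4 * n + 4 < T)
    (he : (machine c).IsComp e T) (hs : (machine c).IsStart (e (4 * n + 4)))
    (hT : (machine c).src (e T) = (machine c).halt) : ∃ m, (simSeq c n m).stm = none := by
  by_contra! hne
  have hchain : ∀ j < T, (e (j + 1) : Trans (stms c)).src =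
      (e j : Trans (stms c)).tgt (tr (trNormal c .halt)) := he.2.1
  have hobs : ∀ j < T, (e j : Trans (stms c)).obs = (stkAt e j (ptr j)).head? := fun j hj => by
    rw [stkAt_ptr]; exact (he.2.2 j hj).symm
  have hini : ∀ j < 4, e j = (.ini (ptr j) : Trans (stms c)) := fun j hj =>
    src_of_chain j hj he.1 fun i hi => hchain i (by omega)
  -- The simulation phase is never left, and step 4n + 4 is still an exit from the loop, so no
  -- earlier exit is possible.
  have hlate : ∀ j ≤ 4 * n + 4, ¬ (e j : Trans (stms c)).src.IsLate := by
    intro j hj hl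
    have key : ∀ k, j ≤ k → k ≤ 4 * n + 4 → (e k : Trans (stms c)).src.IsLate := by
      intro k hjk
      induction k, hjk using Nat.le_induction with
      | base => exact fun _ => hl
      | succ k _ ih =>
        intro hk
        rw [hchain k (by omega)]
        exact isLate_tgt (ih (by omega))
    obtain ⟨o, ho⟩ := hs
    have h := key _ hj le_rfl
    rw [ho] at h
    exact h
  have hload : ∀ j, 4 ≤ j → j < 4 * n + 4 → ∃ o, e j = (.load (ptr j) o : Trans (stms c)) := by
    intro j hj
    have hcase : ∀ j, j < 4 * n + 4 → (e j : Trans (stms c)).src = .load (ptr j) →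
        ∃ o, e j = (.load (ptr j) o : Trans (stms c)) := by
      intro j hj hsrc
      have hl := hlate (j + 1) (by omega)
      rw [hchain j (by omega)] at hl
      rcases hej : (e j : Trans (stms c)) with i | ⟨i, o⟩ | o | ⟨q, s, i, o⟩ <;>
        rw [hej] at hsrc hl
      · exact Ctrl.noConfusion hsrc
      · exact ⟨o, by rw [Ctrl.load.inj hsrc]⟩
      · exact (hl trivial).elim
      · exact (hl (Ctrl.isLate_mk _ _ _)).elim
    induction j, hj using Nat.le_induction with
    | base =>
      intro hj
      refine hcase 4 hj ?_
      rw [hchain 3 (by omega), hini 3 (by norm_num)]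
      rfl
    | succ j _ ih =>
      intro hj
      obtain ⟨o, ho⟩ := ih (by omega)
      refine hcase _ hj ?_
      rw [hchain j (by omega), ho]
      rfl
  have hstk : ∀ j ≤ 4 * n + 4, stkAt e j = loadStk j := by
    intro j
    induction j with
    | zero =>
      intro _
      funext k
      cases k <;> simp [stkAt, loadStk]
    | succ j ih =>
      intro hj
      rw [stkAt, ih (by omega), loadStk_succ]
      congr 2
      change (e j : Trans (stms c)).act = _
      by_cases hj4 : j < 4
      · rw [hini j hj4, if_pos hj4]; rfl
      · obtain ⟨o, ho⟩ := hload j (by omega) (by omega)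
        rw [ho, if_neg hj4]; rfl
  have hsim : ∀ m, 4 * n + 5 + m ≤ T →
      (e (4 * n + 5 + m) : Trans (stms c)).src =
        .mk (simSeq c n m).stm (simSeq c n m).var (simSeq c n m).pos ∧
      stkAt e (4 * n + 5 + m) = (simSeq c n m).stk := by
    intro m
    induction m with
    | zero =>
      intro _
      obtain ⟨o, ho⟩ := hs
      constructor
      · have h := hchain (4 * n + 4) hn
        rw [ho] at h
        exact h
      · change stkAt e (4 * n + 4 + 1) = _
        rw [stkAt, hstk _ le_rfl, ho, loadStk_end]
        exact update_eq_self _ _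
    | succ m ih =>
      intro hm
      obtain ⟨h1, h2⟩ := ih (by omega)
      obtain ⟨q, hq⟩ := Option.ne_none_iff_exists'.1 (hne m)
      have h1' := h1
      rw [hq] at h1'
      obtain ⟨hqX, o, ho⟩ := Trans.eq_sim_of_src h1'
      have hob := hobs (4 * n + 5 + m) (by omega)
      rw [ho, h2, ← simSeq_pos (c := c)] at hob
      -- The observed symbol is the real top of the stack, which determines the transition.
      have hob' : o = ((simSeq c n m).stk (simSeq c n m).pos).head? := hob
      constructor
      · rw [← add_assoc, hchain _ (by omega), ho, simSeq_succ, simNext, hq, ← hob']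
        rfl
      · rw [← add_assoc, stkAt, h2, ho, simSeq_succ, simNext, hq, ← hob', ← simSeq_pos (c := c)]
        rfl
  obtain ⟨m, rfl⟩ := Nat.exists_eq_add_of_le (show 4 * n + 5 ≤ T from hn)
  obtain ⟨q, hq⟩ := Option.ne_none_iff_exists'.1 (hne m)
  have h := (hsim m le_rfl).1
  rw [hq] at h
  exact Ctrl.noConfusion (h.symm.trans hT)

theorem modelChecks_iff (c : Code) (n : ℕ) :
    ModelChecks (machine c).auto (CyclicMachine.haltFormula (30 * (4 * n + 4))) ↔
      (c.eval [2 ^ n - 1]).Dom := by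
  rw [← exists_halt_iff]
  constructor
  · intro h
    obtain ⟨e, T, J, hJT, he, hs, hJ, hT⟩ := CyclicMachine.exists_comp_of_modelChecks h
    obtain rfl : J = 4 * n + 4 := by omega
    exact exists_halt_of_comp hJT he hs hT
  · rintro ⟨m, hm⟩
    obtain ⟨e, he, hT, hs⟩ := exists_comp n m hm
    exact CyclicMachine.modelChecks_of_comp he hT hs (by omega)

/-! ### Undecidability -/

/-- The program searches for the exponent `n` in its input `2 ^ n - 1` and then runs the `n`-th
program on 0. -/
theorem exists_code_halting : ∃ c : Code, ∀ n : ℕ, (c.eval [2 ^ n - 1]).Dom ↔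
    ((Denumerable.ofNat Nat.Partrec.Code n).eval 0).Dom := by
  let g : ℕ →. ℕ := fun m =>
    (Nat.rfind fun n => Part.some (decide (2 ^ n = m + 1))).bind fun n =>
      (Denumerable.ofNat Nat.Partrec.Code n).eval 0
  have hpow : Primrec fun n : ℕ => 2 ^ n :=
    (Primrec.nat_rec₁ 1 (Primrec.nat_mul.comp (Primrec.const 2) Primrec.snd).to₂).of_eq fun n => by
      induction n with
      | zero => rfl
      | succ n ih => rw [pow_succ, mul_comm, ← ih]
  have hg : Partrec g := by
    refine Partrec.bind (Partrec.rfind ?_) ?_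
    · have h : PrimrecPred fun p : ℕ × ℕ => 2 ^ p.2 = p.1 + 1 :=
        Primrec.eq.comp (hpow.comp Primrec.snd) (Primrec.succ.comp Primrec.fst)
      exact h.decide.to_comp.partrec
    · exact Nat.Partrec.Code.eval_part.comp
        ((Computable.ofNat _).comp Computable.snd) (Computable.const 0)
  obtain ⟨c, hc⟩ := Turing.ToPartrec.Code.exists_code (Nat.Partrec'.part_iff₁.2 hg)
  refine ⟨c, fun n => ?_⟩
  have h := hc ((2 ^ n - 1) ::ᵥ List.Vector.nil)
  rw [show c.eval [2 ^ n - 1] = _ from h]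
  have hmem : n ∈ Nat.rfind fun k => Part.some (decide (2 ^ k = 2 ^ n - 1 + 1)) := by
    have h1 := Nat.one_le_two_pow (n := n)
    rw [Nat.sub_add_cancel h1]
    refine Nat.mem_rfind.2 ⟨by simp, fun {m} hm => ?_⟩
    have : (2 : ℕ) ^ m ≠ 2 ^ n := fun h => hm.ne (Nat.pow_right_injective le_rfl h)
    simp [this]
  have hgn : g (2 ^ n - 1) = (Denumerable.ofNat Nat.Partrec.Code n).eval 0 := by
    change Part.bind _ _ = _
    rw [Part.eq_some_iff.2 hmem, Part.bind_some]
  rw [List.Vector.head_cons, hgn]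
  rfl

end StackSim

/-- Only the time bound depends on `n`; the rest of the nested pairing is constant. -/
theorem CyclicMachine.primrec_haltFormula_code :
    Primrec fun n : ℕ => (CyclicMachine.haltFormula (30 * (4 * n + 4))).code := by
  have hc : Primrec fun n : ℕ => 30 * (4 * n + 4) :=
    Primrec.nat_mul.comp (Primrec.const 30)
      (Primrec.nat_add.comp (Primrec.nat_mul.comp (Primrec.const 4) Primrec.id) (Primrec.const 4))
  have hl : ∀ (a : ℕ) {f : ℕ → ℕ}, Primrec f → Primrec fun n => Nat.pair a (f n) :=
    fun a _ hf => Primrec₂.natPair.comp (Primrec.const a) hf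
  have hr : ∀ (a : ℕ) {f : ℕ → ℕ}, Primrec f → Primrec fun n => Nat.pair (f n) a :=
    fun a _ hf => Primrec₂.natPair.comp hf (Primrec.const a)
  have conj : ∀ (φ : WMTL 2) {ψ : ℕ → WMTL 2}, (Primrec fun n => (ψ n).code) →
      Primrec fun n => (WMTL.conj φ (ψ n)).code :=
    fun φ ψ h => hl _ (hl _ (hl _ (hl _ h)))
  exact conj _ (conj _ (conj _ (conj _ (hl _ (hl _ (hl _ (hr _ hc)))))))

end PricedTimed

theorem mainTheorem6 :
    ¬ PricedTimed.ModelCheckingDecidable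
      {A : PricedTimed.PPTA 1 2 | A.NonBlocking ∧ ∀ i : Fin 2, A.IsStopwatch i} := by
  rintro ⟨f, hf, h⟩
  obtain ⟨c, hc⟩ := PricedTimed.StackSim.exists_code_halting
  have key : ∀ n : ℕ, f (Nat.pair (PricedTimed.StackSim.machine c).auto.code
      (PricedTimed.CyclicMachine.haltFormula (30 * (4 * n + 4))).code) = true ↔
      ((Denumerable.ofNat Nat.Partrec.Code n).eval 0).Dom := fun n => by
    rw [h _ ⟨PricedTimed.CyclicMachine.auto_nonBlocking,
      PricedTimed.CyclicMachine.auto_isStopwatch⟩, PricedTimed.StackSim.modelChecks_iff, hc]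
  refine ComputablePred.halting_problem 0 (ComputablePred.computable_iff.2
    ⟨fun p => f (Nat.pair (PricedTimed.StackSim.machine c).auto.code
      (PricedTimed.CyclicMachine.haltFormula (30 * (4 * Encodable.encode p + 4))).code), ?_, ?_⟩)
  -- The automaton was chosen noncomputably, but it is fixed, so its code enters as a constant.
  · exact hf.comp ((Primrec₂.natPair.comp (Primrec.const _)
      (PricedTimed.CyclicMachine.primrec_haltFormula_code.comp Primrec.encode)).to_comp)
  · funext p
    rw [eq_iff_iff, key, Denumerable.ofNat_encode]
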